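/- Let $n,r\in\mathbb{N}$, let $\mathbb{R}^{n\times r}$ carry the Frobenius inner product, let $\mathcal{M}=\mathrm{St}(n,r)=\{X\in\mathbb{R}^{n\times r}: X^\top X=I_r\}$ with the induced metric, and $\mathrm{T}_X\mathcal{M}=\{V: V^\top X+X^\top V=0\}$. Consider $\min_{X\in\mathcal{M}}F(X)$, $F:=f+h$, where $f:\mathbb{R}^{n\times r}\to\mathbb{R}$ is twice continuously differentiable with Lipschitz continuous Euclidean gradient, and $h:\mathbb{R}^{n\times r}\to\mathbb{R}$ is convex (possibly nonsmooth) and Lipschitz continuous with constant $L_h>0$. Write $\mathrm{grad}f(X)$ and $\mathrm{Hess}f(X)$ for the Riemannian gradient and Hessian on $\mathcal{M}$. Let $\mathbf{R}$ be a retraction on $\mathcal{M}$, that is, a smooth map $\mathrm{T}\mathcal{M}\to\mathcal{M}$, $(X,\xi)\mapsto\mathbf{R}_X(\xi)$, with $\mathbf{R}_X(0)=X$ and $\mathrm{D}\mathbf{R}_X(0)=\mathrm{id}_{\mathrm{T}_X\mathcal{M}}$. Assume that $\mathbf{R}$ is of second order, i.e. for all $X\in\mathcal{M}$ and $\xi\in\mathrm{T}_X\mathcal{M}$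 the curve $t\mapsto\mathbf{R}_X(t\xi)$ has zero Riemannian acceleration at $t=0$, and that $\mathbf{R}$ extends to a continuously differentiable map $\mathcal{M}\times\mathbb{R}^{n\times r}\to\mathbb{R}^{n\times r}$ whose Euclidean differential $\mathbb{D}\mathbf{R}_X(\xi)$ in $\xi$ satisfies, for some $M_2>0$, $$\|\mathbb{D}\mathbf{R}_X(\xi)-\mathbb{D}\mathbf{R}_X(\eta)\|\le 2M_2\|\xi-\eta\|\qquad\text{for all }X\in\mathcal{M},\ \xi,\eta\in\mathrm{T}_X\mathcal{M}$$ in the operator norm. Algorithm (ARPN with exact Hessian). Given $X_0\in\mathcal{M}$, $\sigma\in(0,1/4)$, $\gamma\in(0,1)$, $\sigma_0>0$, $0<\eta_1<\eta_2<1$, $0<\gamma_1<1<\gamma_2$, perform for $k=0,1,2,\dots$: 1. Put $H_k=\mathrm{Hess}f(X_k)$. While $\lambda_{\min}(H_k)+\frac12\sigma_k\le 3L_hM_2$, replace $\sigma_k$ by $\gamma_2\sigma_k$. 2. Put $\mathbb{H}_k=H_k+\sigma_kI$ and choose a global minimizer $V_k$ over $\mathrm{T}_{X_k}\mathcal{M}$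 of $\varphi_k(V)=\langle\mathrm{grad}f(X_k),V\rangle+\frac12\langle\mathbb{H}_k[V],V\rangle+h(\mathbf{R}_{X_k}(V))$. 3. Let $\alpha_k$ be the first element of $1,\gamma,\gamma^2,\dots$ with $F(\mathbf{R}_{X_k}(\alpha_kV_k))\le F(X_k)-\frac12\sigma\alpha_k\langle\mathbb{H}_k[V_k],V_k\rangle$, and let $\rho_k=\dfrac{F(\mathbf{R}_{X_k}(\alpha_kV_k))-F(X_k)}{\varphi_k(\alpha_kV_k)-\varphi_k(0)}$. 4. If $\rho_k<\eta_1$, replace $\sigma_k$ by $\gamma_2\sigma_k$ and return to step 2. Otherwise put $X_{k+1}=\mathbf{R}_{X_k}(\alpha_kV_k)$, and $\sigma_{k+1}=\gamma_1\sigma_k$ if $\rho_k\ge\eta_2$, $\sigma_{k+1}=\sigma_k$ if $\rho_k<\eta_2$. Theorem. Let $\{X_k\}$ be a sequence generated by this algorithm for which all the computed directions $V_k$ are nonzero, and suppose that $\{X_k\}$ has an accumulation point $X^*$ such that $\lambda_{\min}(\mathrm{Hess}(f\circ\mathbf{R}_{X^*})(0_{X^*}))\ge\delta$ for some $\delta>5L_hM_2$.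 Then $\{X_k\}$ converges q-superlinearly to $X^*$: $X_k\to X^*$ and $\|X_{k+1}-X^*\|=o(\|X_k-X^*\|)$ as $k\to\infty$. -/

import Mathlib

open Set Filter Topology
open scoped NNReal ContDiff Matrix

noncomputable section

namespace ARPN

/-! ## The Stiefel manifold in `ℝ^{n×r}` -/

/-- The Euclidean space `ℝ^{n×r}` with the Frobenius inner product `⟨A, B⟩ = tr(Aᵀ B)`. -/
abbrev Mat (n r : ℕ) : Type := EuclideanSpace ℝ (Fin n × Fin r)

variable {n r : ℕ}

/-- An element of `ℝ^{n×r}` read as a matrix. -/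
def toMat (X : Mat n r) : Matrix (Fin n) (Fin r) ℝ := Matrix.of fun i j => X (i, j)

/-- A matrix read as an element of `ℝ^{n×r}`. -/
def ofMat (A : Matrix (Fin n) (Fin r) ℝ) : Mat n r := WithLp.toLp 2 fun p => A p.1 p.2

/-- The Stiefel manifold `St(n,r) = {X : Xᵀ X = I}`. -/
def Stiefel (n r : ℕ) : Set (Mat n r) := {X | (toMat X)ᵀ * toMat X = 1}

/-- The tangent space `T_X St(n,r) = {V : Vᵀ X + Xᵀ V = 0}`. -/
def tangent (X : Mat n r) : Submodule ℝ (Mat n r) where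
  carrier := {V | (toMat V)ᵀ * toMat X + (toMat X)ᵀ * toMat V = 0}
  zero_mem' := by
    have h : toMat (0 : Mat n r) = 0 := rfl
    simp [h]
  add_mem' := by
    intro V W hV hW
    have h : toMat (V + W) = toMat V + toMat W := rfl
    simp only [mem_ofPred_eq] at hV hW ⊢
    rw [h, Matrix.transpose_add, Matrix.add_mul, Matrix.mul_add, add_add_add_comm, hV, hW,
      add_zero]
  smul_mem' := by
    intro c V hV
    have h : toMat (c • V) = c • toMat V := rfl
    simp only [mem_ofPred_eq] at hV ⊢
    rw [h, Matrix.transpose_smul, Matrix.smul_mul, Matrix.mul_smul, ← smul_add, hV, smul_zero]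

/-- The tangent bundle of `St(n,r)`, as a subset of `ℝ^{n×r} × ℝ^{n×r}`. -/
def tangentBundle (n r : ℕ) : Set (Mat n r × Mat n r) :=
  {p | p.1 ∈ Stiefel n r ∧ p.2 ∈ tangent p.1}

/-- `V - ½ X (Xᵀ V + Vᵀ X)`: for `X ∈ St(n,r)`, the orthogonal projection of `V` onto the
tangent space at `X`. -/
def tangentProj (X V : Mat n r) : Mat n r :=
  V - (1 / 2 : ℝ) •
    ofMat (toMat X * ((toMat X)ᵀ * toMat V + (toMat V)ᵀ * toMat X))

/-- The Riemannian gradient: the projection of the Euclidean gradient onto the tangent space.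
The formula makes sense on all of `ℝ^{n×r}`. -/
def rgrad (f : Mat n r → ℝ) (X : Mat n r) : Mat n r := tangentProj X (gradient f X)

/-- The Riemannian Hessian of `f` at `X ∈ St(n,r)` for the metric inherited from `ℝ^{n×r}`:
`Hess f(X)[V] = Proj_{T_X} (D (grad f)(X)[V])`, the Levi-Civita connection of an embedded
submanifold being the projected Euclidean derivative. -/
def rHess (f : Mat n r → ℝ) (X : Mat n r) : tangent X →L[ℝ] tangent X :=
  (tangent X).orthogonalProjectionOnto ∘L fderiv ℝ (rgrad f) X ∘L (tangent X).subtypeL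

/-- The Hessian at `0` of the pullback `f ∘ R_X`, a function on the Euclidean space `T_X`. -/
def pullbackHess (f : Mat n r → ℝ) (R : Mat n r → Mat n r → Mat n r) (X : Mat n r) :
    tangent X →L[ℝ] tangent X :=
  fderiv ℝ (gradient fun ξ : tangent X => f (R X ξ)) 0

/-- The smallest eigenvalue of a self-adjoint operator on a nonzero finite-dimensional space,
as the minimum of `⟨H v, v⟩` over unit vectors. -/
def lambdaMin {E : Type*} [NormedAddCommGroup E] [InnerProductSpace ℝ E] (H : E →L[ℝ] E) : ℝ :=
  ⨅ v : Metric.sphere (0 : E) 1, inner ℝ (H v) (v : E)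

/-! ## Retractions -/

/-- `R` restricts to a retraction on `St(n,r)`: a smooth map from the tangent bundle to the
manifold with `R_X(0) = X` and `D R_X(0) = id`. (For an embedded submanifold, smoothness in
charts and `ContDiffOn` on the submanifold are the same thing.) -/
structure IsRetraction (R : Mat n r → Mat n r → Mat n r) : Prop where
  mem : ∀ X ∈ Stiefel n r, ∀ ξ ∈ tangent X, R X ξ ∈ Stiefel n r
  smooth : ContDiffOn ℝ ∞ (fun p : Mat n r × Mat n r => R p.1 p.2) (tangentBundle n r)
  map_zero : ∀ X ∈ Stiefel n r, R X 0 = X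
  deriv_zero : ∀ X ∈ Stiefel n r,
    HasFDerivAt (fun ξ : tangent X => R X ξ) (tangent X).subtypeL 0

/-- `R` is of second order: the curves `t ↦ R_X(tξ)` have zero initial (Riemannian)
acceleration, i.e. the tangential part of their second derivative at `t = 0` vanishes. -/
def IsSecondOrder (R : Mat n r → Mat n r → Mat n r) : Prop :=
  ∀ X ∈ Stiefel n r, ∀ ξ ∈ tangent X,
    (tangent X).orthogonalProjectionOnto (iteratedDeriv 2 (fun t : ℝ => R X (t • ξ)) 0) = 0

/-- `R` is continuously differentiable on `St(n,r) × ℝ^{n×r}`, and its Euclidean differential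
in the second variable is Lipschitz with constant `2 M₂` along each tangent space. -/
structure HasLipschitzDifferential (R : Mat n r → Mat n r → Mat n r) (M₂ : ℝ) : Prop where
  contDiffOn : ContDiffOn ℝ 1 (fun p : Mat n r × Mat n r => R p.1 p.2) (Stiefel n r ×ˢ univ)
  lipschitz : ∀ X ∈ Stiefel n r, ∀ ξ ∈ tangent X, ∀ η ∈ tangent X,
    ‖fderiv ℝ (R X) ξ - fderiv ℝ (R X) η‖ ≤ 2 * M₂ * ‖ξ - η‖

/-! ## The algorithm -/

/-- The parameters of the algorithm: line-search parameters `σ ∈ (0, 1/4)` and `γ ∈ (0,1)`, the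
initial regularization parameter `σ₀ > 0`, and `0 < η₁ < η₂ < 1`, `0 < γ₁ < 1 < γ₂`. -/
structure Params where
  σ : ℝ
  γ : ℝ
  σ₀ : ℝ
  η₁ : ℝ
  η₂ : ℝ
  γ₁ : ℝ
  γ₂ : ℝ
  σ_pos : 0 < σ
  σ_lt : σ < 1 / 4
  γ_pos : 0 < γ
  γ_lt : γ < 1
  σ₀_pos : 0 < σ₀
  η₁_pos : 0 < η₁
  η₁_lt : η₁ < η₂
  η₂_lt : η₂ < 1
  γ₁_pos : 0 < γ₁
  γ₁_lt : γ₁ < 1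
  γ₂_gt : 1 < γ₂

/-- The regularized operator `H + s I`. -/
def regularize {X : Mat n r} (H : tangent X →L[ℝ] tangent X) (s : ℝ) :
    tangent X →L[ℝ] tangent X :=
  H + s • ContinuousLinearMap.id ℝ (tangent X)

/-- The model `φ(V) = ⟨grad f(X), V⟩ + ½ ⟨ℍ[V], V⟩ + h(R_X(V))` on `T_X`. -/
def model (f h : Mat n r → ℝ) (R : Mat n r → Mat n r → Mat n r) (X : Mat n r)
    (ℍ : tangent X →L[ℝ] tangent X) (V : tangent X) : ℝ :=
  inner ℝ (rgrad f X) (V : Mat n r) + (1 / 2) * inner ℝ (ℍ V) V + h (R X V)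

/-- The line-search condition for the stepsize `α`, with `F = f + h`:
`F(R_X(αV)) ≤ F(X) - ½ σ α ‖V‖²_ℍ`. -/
def Armijo (P : Params) (f h : Mat n r → ℝ) (R : Mat n r → Mat n r → Mat n r) (X : Mat n r)
    (ℍ : tangent X →L[ℝ] tangent X) (V : tangent X) (α : ℝ) : Prop :=
  f (R X (α • V : tangent X)) + h (R X (α • V : tangent X)) ≤
    f X + h X - (1 / 2) * P.σ * α * inner ℝ (ℍ V) V

/-- The ratio `ρ = (F(R_X(αV)) - F(X)) / (φ(αV) - φ(0))`, with `F = f + h`. -/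
def ratio (f h : Mat n r → ℝ) (R : Mat n r → Mat n r → Mat n r) (X : Mat n r)
    (ℍ : tangent X →L[ℝ] tangent X) (V : tangent X) (α : ℝ) : ℝ :=
  (f (R X (α • V : tangent X)) + h (R X (α • V : tangent X)) - (f X + h X)) /
    (model f h R X ℍ (α • V) - model f h R X ℍ 0)

/-- One infinite run of the algorithm, with operators `H k` on the tangent space at `X k`.

* `X k`, `s k`: the iterate and the regularization parameter at the start of iteration `k`;
* `p k`: how often the parameter is multiplied by `γ₂` in the first `while` loop
  (the loop that enforces `λ_min(H_k) + σ_k / 2 > κ₃ = 3 L_h M₂`);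
* `J k`: the number of rejected passes of the main inner loop; the passes are
  `j = 0, …, J k`, and pass `J k` is the accepted one;
* `V k j`, `N k j`: the search direction and the number of backtracking steps in pass `j`. -/
structure Run (n r : ℕ) where
  X : ℕ → Mat n r
  s : ℕ → ℝ
  H : ∀ k, tangent (X k) →L[ℝ] tangent (X k)
  p : ℕ → ℕ
  J : ℕ → ℕ
  V : ∀ k, ℕ → tangent (X k)
  N : ℕ → ℕ → ℕ

namespace Run

/-- The value of the regularization parameter in pass `j` of the inner loop. -/
def reg (T : Run n r) (P : Params) (k j : ℕ) : ℝ := P.γ₂ ^ (T.p k + j) * T.s k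

/-- The operator `ℍ_k = H_k + σ_k I` in pass `j` of the inner loop. -/
def op (T : Run n r) (P : Params) (k j : ℕ) : tangent (T.X k) →L[ℝ] tangent (T.X k) :=
  regularize (T.H k) (T.reg P k j)

/-- The stepsize found by the line search in pass `j` of the inner loop. -/
def step (T : Run n r) (P : Params) (k j : ℕ) : ℝ := P.γ ^ T.N k j

/-- The ratio `ρ_k` computed in pass `j` of the inner loop. -/
def rho (T : Run n r) (P : Params) (f h : Mat n r → ℝ) (R : Mat n r → Mat n r → Mat n r)
    (k j : ℕ) : ℝ :=
  ratio f h R (T.X k) (T.op P k j) (T.V k j) (T.step P k j)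

/-- The data `T` were produced by the algorithm. -/
structure IsGenerated (T : Run n r) (P : Params) (f h : Mat n r → ℝ)
    (R : Mat n r → Mat n r → Mat n r) (Lh M₂ : ℝ) : Prop where
  init_mem : T.X 0 ∈ Stiefel n r
  init_reg : T.s 0 = P.σ₀
  /-- the first `while` loop stops as soon as `λ_min(H_k) + σ_k / 2 > 3 L_h M₂` -/
  first_loop : ∀ k, IsLeast
    {q : ℕ | 3 * Lh * M₂ < lambdaMin (T.H k) + (1 / 2) * (P.γ₂ ^ q * T.s k)} (T.p k)
  /-- each search direction is a minimizer of the subproblem -/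
  direction : ∀ k, ∀ j ≤ T.J k, ∀ W : tangent (T.X k),
    model f h R (T.X k) (T.op P k j) (T.V k j) ≤ model f h R (T.X k) (T.op P k j) W
  /-- backtracking line search from the stepsize `1` with factor `γ` -/
  line_search : ∀ k, ∀ j ≤ T.J k, IsLeast
    {m : ℕ | Armijo P f h R (T.X k) (T.op P k j) (T.V k j) (P.γ ^ m)} (T.N k j)
  rejected : ∀ k, ∀ j < T.J k, T.rho P f h R k j < P.η₁
  accepted : ∀ k, P.η₁ ≤ T.rho P f h R k (T.J k)
  next_point : ∀ k, T.X (k + 1) =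
    R (T.X k) (T.step P k (T.J k) • T.V k (T.J k) : tangent (T.X k))
  next_reg : ∀ k,
    (P.η₂ ≤ T.rho P f h R k (T.J k) → T.s (k + 1) = P.γ₁ * T.reg P k (T.J k)) ∧
    (T.rho P f h R k (T.J k) < P.η₂ → T.s (k + 1) = T.reg P k (T.J k))

end Run

/-- `x_k → x*` with `‖x_{k+1} - x*‖ = o(‖x_k - x*‖)`. -/
def ConvergesQSuperlinearly {E : Type*} [NormedAddCommGroup E] (x : ℕ → E) (xs : E) : Prop :=
  Tendsto x atTop (𝓝 xs) ∧
    Asymptotics.IsLittleO atTop (fun k => x (k + 1) - xs) (fun k => x k - xs)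

end ARPN

end

namespace ARPN

/-! ### The Stiefel manifold, its tangent spaces and the projection onto them. -/

variable {n r : ℕ}

/-! Write `λ = L_h M₂` and `F = f + h`. On a tangent space `R_X` differs from its linearization at
any point by at most `M₂ ‖·‖²`, so `h ∘ R_X` becomes convex once `λ ‖·‖²` is added
(`comp_retr_weakly_convex`). A quadratic part that is at least `3λ ‖·‖²` therefore makes the model
strongly convex, and the model grows quadratically away from its minimizer
(`model_minimizer_growth`). Every later estimate tests this growth inequality at a suitable vector.

Global part. Testing at `0` gives bounded directions, stepsizes bounded below and a decrease of `F`
proportional to `‖V_k‖²`; a large regularization parameter forces acceptance, so the parameters stay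
bounded. As `F(X_k)` decreases and `X*` is an accumulation point, `F(X*) ≤ F(X_k)` for all `k`.
Hence `V_k → 0`, and by `norm_minimizer_le` this extends to the directions of rejected passes.

Local part. For a second-order retraction the Hessian of the pullback is the Riemannian Hessian, so
near `X*` the latter is at least `5λ`. A uniform second-order Taylor expansion then shows that small
directions are accepted in the first pass with unit stepsize and ratio at least `η₂`, so that
`σ_{k+1} = γ₁ σ_k`.

For the error, write `X* = R_X(ξ)` with `‖ξ‖` comparable to `‖X - X*‖` (`exists_retr_eq`) and test
the growth at `ξ`. Replacing model values by values of `F` through Taylor and using `F(X*) ≤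
F(R_X(V))` leaves `(3λ + σ) ‖ξ - V‖² ≤ σ (‖ξ‖² - ‖V‖²) + o(‖ξ‖² + ‖V‖²)`, hence `(3λ + σ) ‖X⁺ - X*‖²
≤ (σ + ε) ‖X - X*‖²`. With `ε = λ` this is a contraction that traps the sequence after one late
visit near `X*`. From then on `σ_k → 0` geometrically, and as `ε` is arbitrary the rate is
superlinear. -/

theorem toMat_apply (X : Mat n r) (i : Fin n) (j : Fin r) : toMat X i j = X (i, j) := rfl

theorem ofMat_apply (A : Matrix (Fin n) (Fin r) ℝ) (p : Fin n × Fin r) :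
    ofMat A p = A p.1 p.2 := rfl

theorem toMat_ofMat (A : Matrix (Fin n) (Fin r) ℝ) : toMat (ofMat A) = A := rfl

theorem toMat_sub (X Y : Mat n r) : toMat (X - Y) = toMat X - toMat Y := rfl

theorem continuous_toMat : Continuous (toMat : Mat n r → _) := by
  refine continuous_matrix fun i j => ?_
  simp only [toMat_apply]
  fun_prop

theorem inner_eq_trace (A B : Mat n r) :
    inner ℝ A B = ((toMat A)ᵀ * toMat B).trace := by
  simp only [PiLp.inner_apply, Matrix.trace, Matrix.diag, Matrix.mul_apply, Matrix.transpose_apply,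
    toMat_apply, Fintype.sum_prod_type, RCLike.inner_apply, conj_trivial]
  rw [Finset.sum_comm]
  simp_rw [mul_comm]

theorem mem_tangent {X V : Mat n r} :
    V ∈ tangent X ↔ (toMat V)ᵀ * toMat X + (toMat X)ᵀ * toMat V = 0 := Iff.rfl

theorem mem_stiefel {X : Mat n r} : X ∈ Stiefel n r ↔ (toMat X)ᵀ * toMat X = 1 := Iff.rfl

theorem norm_sq_of_mem_stiefel {X : Mat n r} (hX : X ∈ Stiefel n r) : ‖X‖ ^ 2 = r := by
  rw [← real_inner_self_eq_norm_sq, inner_eq_trace, mem_stiefel.1 hX]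
  simp

theorem isClosed_stiefel : IsClosed (Stiefel n r) :=
  isClosed_eq ((continuous_toMat.matrix_transpose).matrix_mul continuous_toMat) continuous_const

theorem isCompact_stiefel : IsCompact (Stiefel n r) := by
  refine Metric.isCompact_of_isClosed_isBounded isClosed_stiefel ?_
  refine (Metric.isBounded_closedBall (x := (0 : Mat n r)) (r := √r)).subset fun X hX => ?_
  rw [mem_closedBall_zero_iff]
  exact Real.le_sqrt_of_sq_le (norm_sq_of_mem_stiefel hX).le

theorem isClosed_setOf_mem_tangent :
    IsClosed {p : Mat n r × Mat n r | p.2 ∈ tangent p.1} := by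
  have h1 : Continuous fun p : Mat n r × Mat n r => toMat p.1 := continuous_toMat.comp continuous_fst
  have h2 : Continuous fun p : Mat n r × Mat n r => toMat p.2 := continuous_toMat.comp continuous_snd
  exact isClosed_eq ((h2.matrix_transpose.matrix_mul h1).add (h1.matrix_transpose.matrix_mul h2))
    continuous_const

theorem toMat_tangentProj (X V : Mat n r) : toMat (tangentProj X V) =
    toMat V - (1 / 2 : ℝ) • (toMat X * ((toMat X)ᵀ * toMat V + (toMat V)ᵀ * toMat X)) := rfl

theorem tangentProj_mem {X : Mat n r} (hX : X ∈ Stiefel n r) (V : Mat n r) :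
    tangentProj X V ∈ tangent X := by
  rw [mem_tangent, toMat_tangentProj]
  rw [mem_stiefel] at hX
  simp only [Matrix.transpose_sub, Matrix.transpose_smul, Matrix.transpose_mul,
    Matrix.transpose_add, Matrix.transpose_transpose, Matrix.sub_mul, Matrix.mul_sub,
    Matrix.smul_mul, Matrix.mul_smul, Matrix.mul_assoc, hX, Matrix.mul_one]
  rw [← Matrix.mul_assoc (toMat X)ᵀ (toMat X), hX, Matrix.one_mul,
    add_comm ((toMat V)ᵀ * toMat X)]
  module

/-- The subtracted term is `½ X S` with `S` symmetric, while `Xᵀ W` is skew for tangent `W`, so the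
trace of their product vanishes. With `tangentProj_mem` this identifies the formula with the
orthogonal projection. -/
theorem inner_tangentProj (X V : Mat n r) {W : Mat n r} (hW : W ∈ tangent X) :
    inner ℝ (tangentProj X V) W = inner ℝ V W := by
  rw [tangentProj, inner_sub_left, inner_smul_left, inner_eq_trace (ofMat _), toMat_ofMat]
  set S := (toMat X)ᵀ * toMat V + (toMat V)ᵀ * toMat X with hS
  have hST : Sᵀ = S := by
    simp [hS, Matrix.transpose_mul, add_comm]
  have hsk : (toMat W)ᵀ * toMat X = -((toMat X)ᵀ * toMat W) :=
    eq_neg_of_add_eq_zero_left (mem_tangent.1 hW)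
  have h0 : ((toMat X * S)ᵀ * toMat W).trace = 0 := by
    have h1 : ((toMat X * S)ᵀ * toMat W).trace = (S * ((toMat X)ᵀ * toMat W)).trace := by
      rw [Matrix.transpose_mul, hST, Matrix.mul_assoc]
    have h2 : (S * ((toMat X)ᵀ * toMat W)).trace = -(S * ((toMat X)ᵀ * toMat W)).trace := by
      conv_lhs => rw [← Matrix.trace_transpose, Matrix.transpose_mul, hST, Matrix.transpose_mul,
        Matrix.transpose_transpose, hsk, Matrix.neg_mul, Matrix.trace_neg, Matrix.trace_mul_comm]
    rw [h1]; linarith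
  rw [h0]; simp

theorem rgrad_mem {X : Mat n r} (hX : X ∈ Stiefel n r) (f : Mat n r → ℝ) :
    rgrad f X ∈ tangent X := tangentProj_mem hX _

theorem inner_rgrad (f : Mat n r → ℝ) {X W : Mat n r} (hW : W ∈ tangent X) :
    inner ℝ (rgrad f X) W = inner ℝ (gradient f X) W := inner_tangentProj X _ hW

theorem contDiff_gradient {E : Type*} [NormedAddCommGroup E] [InnerProductSpace ℝ E]
    [CompleteSpace E] {f : E → ℝ} (hf : ContDiff ℝ 2 f) : ContDiff ℝ 1 (gradient f) :=
  (InnerProductSpace.toDual ℝ E).symm.contDiff.comp (hf.fderiv_right (by norm_num))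

theorem contDiff_tangentProj :
    ContDiff ℝ ∞ fun p : Mat n r × Mat n r => tangentProj p.1 p.2 := by
  rw [contDiff_euclidean]
  rintro ⟨i, j⟩
  simp only [tangentProj, PiLp.sub_apply, PiLp.smul_apply, ofMat_apply, Matrix.mul_apply,
    Matrix.add_apply, Matrix.transpose_apply, toMat_apply, smul_eq_mul]
  fun_prop

theorem contDiff_rgrad {f : Mat n r → ℝ} (hf : ContDiff ℝ 2 f) : ContDiff ℝ 1 (rgrad f) :=
  (contDiff_tangentProj.of_le (by exact_mod_cast le_top)).comp
    (contDiff_id.prodMk (contDiff_gradient hf))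

/-- Differentiate the entries of `c(u)ᵀ c(u) = I`. -/
theorem mem_tangent_of_hasDerivAt {c : ℝ → Mat n r} {c' : Mat n r} {t : ℝ}
    (h : HasDerivAt c c' t) (hc : ∀ u, c u ∈ Stiefel n r) : c' ∈ tangent (c t) := by
  rw [mem_tangent]
  ext j k
  have hp : ∀ p, HasDerivAt (fun u => c u p) (c' p) t := fun p =>
    (EuclideanSpace.proj (𝕜 := ℝ) p).hasFDerivAt.comp_hasDerivAt t h
  have h1 : HasDerivAt (fun u => ∑ i, c u (i, j) * c u (i, k))
      (∑ i, (c' (i, j) * c t (i, k) + c t (i, j) * c' (i, k))) t :=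
    HasDerivAt.fun_sum fun i _ => (hp (i, j)).mul (hp (i, k))
  have h2 : (fun u => ∑ i, c u (i, j) * c u (i, k)) = fun _ => (1 : Matrix (Fin r) (Fin r) ℝ) j k := by
    funext u
    have := congrFun (congrFun (mem_stiefel.1 (hc u)) j) k
    simpa [Matrix.mul_apply, toMat_apply] using this
  rw [h2] at h1
  have h3 := h1.unique (hasDerivAt_const t _)
  simpa [Matrix.mul_apply, toMat_apply, Finset.sum_add_distrib] using h3

/-! ### Injectivity of the tangent projection on the manifold. -/

section Frobenius

attribute [local instance] Matrix.frobeniusNormedAddCommGroup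

theorem norm_toMat (X : Mat n r) : ‖toMat X‖ = ‖X‖ := by
  rw [Matrix.frobenius_norm_def, EuclideanSpace.norm_eq, Fintype.sum_prod_type,
    Real.sqrt_eq_rpow]
  simp [toMat_apply]

/-- Near `X ∈ St(n,r)`, the projection onto the tangent space at `X` is injective on the
manifold. -/
theorem eq_of_tangentProj_sub_eq_zero {X Y Z : Mat n r} (hY : Y ∈ Stiefel n r)
    (hZ : Z ∈ Stiefel n r) (h : tangentProj X (Y - Z) = 0)
    (hsmall : ‖X‖ * (‖Y - Z‖ + 2 * ‖Z - X‖) < 2) : Y = Z := by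
  by_contra hne
  have hD : 0 < ‖Y - Z‖ := norm_pos_iff.2 (sub_ne_zero.2 hne)
  set S := (toMat X)ᵀ * toMat (Y - Z) + (toMat (Y - Z))ᵀ * toMat X with hS
  have h1 : toMat (Y - Z) = (1 / 2 : ℝ) • (toMat X * S) := by
    have := congrArg toMat h
    rw [toMat_tangentProj] at this
    exact sub_eq_zero.1 this
  -- By `YᵀY = ZᵀZ`, `S` is a sum of products of two small factors, one of them `Y - Z`. Since `Y -
  -- Z = ½ X S`, its norm would be smaller than itself.
  have h2 : S = -((toMat (Y - Z))ᵀ * toMat (Y - Z)) - (toMat (Y - Z))ᵀ * toMat (Z - X)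
      - (toMat (Z - X))ᵀ * toMat (Y - Z) := by
    have hYZ : (toMat Y)ᵀ * toMat Y - (toMat Z)ᵀ * toMat Z = 0 := by
      rw [mem_stiefel.1 hY, mem_stiefel.1 hZ, sub_self]
    rw [hS, ← sub_eq_zero, ← hYZ]
    simp only [toMat_sub, Matrix.transpose_sub, Matrix.sub_mul, Matrix.mul_sub]
    abel
  have h3 : ‖S‖ ≤ ‖Y - Z‖ * (‖Y - Z‖ + 2 * ‖Z - X‖) := by
    have a1 := Matrix.frobenius_norm_mul (toMat (Y - Z))ᵀ (toMat (Y - Z))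
    have a2 := Matrix.frobenius_norm_mul (toMat (Y - Z))ᵀ (toMat (Z - X))
    have a3 := Matrix.frobenius_norm_mul (toMat (Z - X))ᵀ (toMat (Y - Z))
    rw [Matrix.frobenius_norm_transpose] at a1 a2 a3
    simp only [norm_toMat] at a1 a2 a3
    rw [h2]
    refine (norm_sub_le _ _).trans ?_
    have a4 := norm_sub_le (-((toMat (Y - Z))ᵀ * toMat (Y - Z)))
      ((toMat (Y - Z))ᵀ * toMat (Z - X))
    rw [norm_neg] at a4
    linarith
  have h4 : ‖Y - Z‖ ≤ (1 / 2) * (‖X‖ * ‖S‖) := by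
    have a1 := Matrix.frobenius_norm_mul (toMat X) S
    rw [norm_toMat] at a1
    have a2 : ‖toMat (Y - Z)‖ = (1 / 2) * ‖toMat X * S‖ := by
      let _ := Matrix.frobeniusNormedSpace (R := ℝ) (α := ℝ) (m := Fin n) (n := Fin r)
      rw [h1, norm_smul]; norm_num
    rw [norm_toMat] at a2
    linarith
  have h5 : ‖X‖ * ‖S‖ ≤ ‖X‖ * (‖Y - Z‖ * (‖Y - Z‖ + 2 * ‖Z - X‖)) :=
    mul_le_mul_of_nonneg_left h3 (norm_nonneg _)
  nlinarith

end Frobenius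

/-! ### Taylor estimates from a Lipschitz differential. -/

section Calculus

variable {E F : Type*} [NormedAddCommGroup E] [NormedSpace ℝ E] [NormedAddCommGroup F]
  [NormedSpace ℝ F]

/-- First-order Taylor estimate for a map whose differential is Lipschitz with constant `2 M`
along a segment. -/
theorem norm_sub_sub_fderiv_le {c : E → F} {M : ℝ} {z v : E} (hc : Differentiable ℝ c)
    (hL : ∀ t ∈ Icc (0 : ℝ) 1, ‖fderiv ℝ c (z + t • (v - z)) - fderiv ℝ c z‖ ≤
      2 * M * ‖t • (v - z)‖) :
    ‖c v - c z - fderiv ℝ c z (v - z)‖ ≤ M * ‖v - z‖ ^ 2 := by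
  set d := v - z with hd
  set m : ℝ → F := fun t => c (z + t • d) - c z - t • fderiv ℝ c z d with hm
  have hline : ∀ t : ℝ, HasDerivAt (fun t : ℝ => z + t • d) d t := fun t => by
    simpa using ((hasDerivAt_id t).smul_const d).const_add z
  have hder : ∀ t : ℝ, HasDerivAt m (fderiv ℝ c (z + t • d) d - fderiv ℝ c z d) t := fun t => by
    have h1 := (hc (z + t • d)).hasFDerivAt.comp_hasDerivAt t (hline t)
    have h2 := (hasDerivAt_id t).smul_const (fderiv ℝ c z d)
    exact ((h1.sub_const (c z)).fun_sub h2).congr_deriv (by simp)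
  have hB : ∀ t : ℝ, HasDerivAt (fun t : ℝ => M * ‖d‖ ^ 2 * t ^ 2) (2 * M * ‖d‖ ^ 2 * t) t :=
    fun t => ((hasDerivAt_pow 2 t).const_mul (M * ‖d‖ ^ 2)).congr_deriv (by norm_num; ring)
  have key := image_norm_le_of_norm_deriv_right_le_deriv_boundary (a := (0 : ℝ)) (b := 1) (f := m)
    (fun t _ => (hder t).continuousAt.continuousWithinAt)
    (fun t _ => (hder t).hasDerivWithinAt) (by simp [hm]) hB ?_ (right_mem_Icc.2 zero_le_one)
  · have h1 : z + d = v := by rw [hd]; abel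
    simpa [hm, h1] using key
  · intro t ht
    have h1 := hL t ⟨ht.1, ht.2.le⟩
    rw [norm_smul, Real.norm_of_nonneg ht.1] at h1
    rw [← sub_apply]
    calc _ ≤ ‖fderiv ℝ c (z + t • d) - fderiv ℝ c z‖ * ‖d‖ := ContinuousLinearMap.le_opNorm _ _
      _ ≤ (2 * M * (t * ‖d‖)) * ‖d‖ := mul_le_mul_of_nonneg_right h1 (norm_nonneg _)
      _ = _ := by ring

/-- Descent lemma. -/
theorem le_add_inner_gradient {E : Type*} [NormedAddCommGroup E] [InnerProductSpace ℝ E]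
    [CompleteSpace E] {f : E → ℝ} {L : ℝ≥0} (hf : Differentiable ℝ f)
    (hL : LipschitzWith L (gradient f)) (x y : E) :
    f y ≤ f x + inner ℝ (gradient f x) (y - x) + L * ‖y - x‖ ^ 2 := by
  have hg : ∀ z, fderiv ℝ f z = InnerProductSpace.toDual ℝ E (gradient f z) := fun z => by
    simp [gradient]
  -- The sharp choice is `M = L / 2`; only the existence of a quadratic bound matters later.
  have h := norm_sub_sub_fderiv_le (M := (L : ℝ)) (z := x) (v := y) hf (fun t _ => by
    rw [hg, hg, ← map_sub, LinearIsometryEquiv.norm_map]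
    have := hL.norm_sub_le (x + t • (y - x)) x
    rw [add_sub_cancel_left] at this
    have h0 : 0 ≤ (L : ℝ) * ‖t • (y - x)‖ := by positivity
    linarith)
  rw [hg, InnerProductSpace.toDual_apply_apply, Real.norm_eq_abs] at h
  linarith [(abs_le.1 h).2]

end Calculus

/-! ### The retraction as a perturbation of the identity; weak convexity of `h ∘ R_X`. -/

section Retraction

variable {R : Mat n r → Mat n r → Mat n r} {M₂ : ℝ} {X : Mat n r}

theorem HasLipschitzDifferential.differentiable (hRL : HasLipschitzDifferential R M₂)
    (hX : X ∈ Stiefel n r) : Differentiable ℝ (R X) := by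
  have h : ContDiffOn ℝ 1 (fun ξ : Mat n r => R X ξ) univ :=
    hRL.contDiffOn.comp (contDiff_const.prodMk contDiff_id).contDiffOn
      (fun ξ _ => ⟨hX, mem_univ _⟩)
  exact (contDiffOn_univ.1 h).differentiable one_ne_zero

/-- The ambient differential restricts to the differential of the retraction, which is the identity.
Nothing is claimed in normal directions, so the later estimates stay on the tangent space. -/
theorem IsRetraction.fderiv_zero (hR : IsRetraction R) (hRL : HasLipschitzDifferential R M₂)
    (hX : X ∈ Stiefel n r) (V : tangent X) : fderiv ℝ (R X) 0 (V : Mat n r) = V := by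
  have h1 : HasFDerivAt (fun ξ : tangent X => R X ξ)
      ((fderiv ℝ (R X) 0) ∘L (tangent X).subtypeL) 0 :=
    HasFDerivAt.comp (0 : tangent X) (g := R X) (f := fun ξ : tangent X => (ξ : Mat n r))
      ((hRL.differentiable hX) _).hasFDerivAt (tangent X).subtypeL.hasFDerivAt
  have := congrArg (fun A : tangent X →L[ℝ] Mat n r => A V) (h1.unique (hR.deriv_zero X hX))
  simpa using this

theorem HasLipschitzDifferential.norm_sub_sub_le (hRL : HasLipschitzDifferential R M₂)
    (hX : X ∈ Stiefel n r) (V Z : tangent X) :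
    ‖R X V - R X Z - fderiv ℝ (R X) Z ((V : Mat n r) - Z)‖ ≤ M₂ * ‖V - Z‖ ^ 2 := by
  refine norm_sub_sub_fderiv_le (hRL.differentiable hX) fun t _ => ?_
  have h := hRL.lipschitz X hX (Z + t • (V - Z) : tangent X) (Z + t • (V - Z)).2 Z Z.2
  simpa using h

theorem HasLipschitzDifferential.norm_retr_sub_sub_le (hR : IsRetraction R)
    (hRL : HasLipschitzDifferential R M₂) (hX : X ∈ Stiefel n r) (V : tangent X) :
    ‖R X V - X - V‖ ≤ M₂ * ‖V‖ ^ 2 := by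
  have h := hRL.norm_sub_sub_le hX V 0
  have h0 := hR.fderiv_zero hRL hX V
  simpa [hR.map_zero X hX, h0] using h

/-- Near the origin the retraction is a small perturbation of a translation. -/
theorem HasLipschitzDifferential.norm_retr_sub_retr_le (hR : IsRetraction R)
    (hRL : HasLipschitzDifferential R M₂) (hM : 0 ≤ M₂) (hX : X ∈ Stiefel n r) {ε : ℝ}
    {V W : tangent X} (hV : ‖V‖ ≤ ε) (hW : ‖W‖ ≤ ε) :
    ‖R X V - R X W - ((V : Mat n r) - W)‖ ≤ 2 * M₂ * ε * ‖V - W‖ := by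
  have hdiff := hRL.differentiable hX
  have hder : ∀ ξ ∈ Metric.closedBall (0 : tangent X) ε,
      HasFDerivWithinAt (fun ξ : tangent X => R X ξ)
        ((fderiv ℝ (R X) ξ) ∘L (tangent X).subtypeL) (Metric.closedBall 0 ε) ξ := fun ξ _ =>
    (HasFDerivAt.comp ξ (g := R X) (f := fun ξ : tangent X => (ξ : Mat n r))
      (hdiff _).hasFDerivAt (tangent X).subtypeL.hasFDerivAt).hasFDerivWithinAt
  have h := (convex_closedBall (0 : tangent X) ε).norm_image_sub_le_of_norm_hasFDerivWithin_le'
    (f := fun ξ : tangent X => R X ξ) (φ := (tangent X).subtypeL) (C := 2 * M₂ * ε)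
    (x := W) (y := V) hder ?_ (by simpa using hW) (by simpa using hV)
  · simpa using h
  · intro ξ hξ
    rw [mem_closedBall_zero_iff] at hξ
    refine ContinuousLinearMap.opNorm_le_bound _ ?_ fun U => ?_
    · have := (norm_nonneg ξ).trans hξ
      positivity
    · have h1 := hRL.lipschitz X hX ξ ξ.2 0 (zero_mem _)
      have h2 := ContinuousLinearMap.le_opNorm (fderiv ℝ (R X) ξ - fderiv ℝ (R X) 0) (U : Mat n r)
      rw [sub_apply, hR.fderiv_zero hRL hX] at h2
      have h3 : ‖fderiv ℝ (R X) ξ - fderiv ℝ (R X) 0‖ ≤ 2 * M₂ * ε := by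
        refine h1.trans ?_
        rw [sub_zero]
        exact mul_le_mul_of_nonneg_left hξ (by positivity)
      calc _ ≤ _ := h2
        _ ≤ _ := mul_le_mul_of_nonneg_right h3 (norm_nonneg _)

/-- A convex Lipschitz function composed with the retraction is weakly convex. -/
theorem comp_retr_weakly_convex (hRL : HasLipschitzDifferential R M₂) (hX : X ∈ Stiefel n r)
    {h : Mat n r → ℝ} {Lh : ℝ≥0} (hh : ConvexOn ℝ univ h) (hhL : LipschitzWith Lh h)
    (V W : tangent X) {t : ℝ} (ht0 : 0 ≤ t) (ht1 : t ≤ 1) :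
    h (R X (V + t • (W - V) : tangent X)) ≤ (1 - t) * h (R X V) + t * h (R X W) +
      Lh * M₂ * (t * (1 - t)) * ‖W - V‖ ^ 2 := by
  -- Both endpoints are expanded at the intermediate point `Z`: the first-order terms cancel in the
  -- convex combination, and the remainders add up to `M₂ ((1 - t) t² + t (1 - t)²) = M₂ t (1 - t)`
  -- times `‖W - V‖²`.
  set Z : tangent X := V + t • (W - V) with hZ
  have hVZ : V - Z = (-t) • (W - V) := by rw [hZ]; module
  have hWZ : W - Z = (1 - t) • (W - V) := by rw [hZ]; module
  have e1 := hRL.norm_sub_sub_le hX V Z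
  have e2 := hRL.norm_sub_sub_le hX W Z
  rw [hVZ, norm_smul, norm_neg, Real.norm_of_nonneg ht0] at e1
  rw [hWZ, norm_smul, Real.norm_of_nonneg (sub_nonneg.2 ht1)] at e2
  have hVZ' : (V : Mat n r) - Z = (-t) • ((W : Mat n r) - V) := congrArg Subtype.val hVZ
  have hWZ' : (W : Mat n r) - Z = (1 - t) • ((W : Mat n r) - V) := congrArg Subtype.val hWZ
  rw [hVZ', map_smul] at e1
  rw [hWZ', map_smul] at e2
  set D := fderiv ℝ (R X) Z ((W : Mat n r) - V)
  have hcv := hh.2 (mem_univ (R X V)) (mem_univ (R X W)) (sub_nonneg.2 ht1) ht0 (by ring)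
  have hlip := hhL.dist_le_mul (R X Z) ((1 - t) • R X V + t • R X W)
  rw [Real.dist_eq, dist_eq_norm] at hlip
  have hdiff : ‖R X Z - ((1 - t) • R X V + t • R X W)‖ ≤ M₂ * (t * (1 - t)) * ‖W - V‖ ^ 2 := by
    have h1 : R X Z - ((1 - t) • R X V + t • R X W) =
        -((1 - t) • (R X V - R X Z - (-t) • D) + t • (R X W - R X Z - (1 - t) • D)) := by module
    rw [h1, norm_neg]
    refine (norm_add_le _ _).trans ?_
    rw [norm_smul, norm_smul, Real.norm_of_nonneg ht0, Real.norm_of_nonneg (sub_nonneg.2 ht1)]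
    have a1 := mul_le_mul_of_nonneg_left e1 (sub_nonneg.2 ht1)
    have a2 := mul_le_mul_of_nonneg_left e2 ht0
    refine (add_le_add a1 a2).trans (le_of_eq ?_)
    ring
  have h2 := (le_abs_self _).trans (hlip.trans (mul_le_mul_of_nonneg_left hdiff Lh.2))
  simp only [smul_eq_mul] at hcv
  nlinarith

end Retraction

/-! ### Strong convexity of the model and growth at its minimizer. -/

section Model

variable {R : Mat n r → Mat n r → Mat n r} {M₂ : ℝ} {X : Mat n r} {f h : Mat n r → ℝ} {Lh : ℝ≥0}
  {H : tangent X →L[ℝ] tangent X}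

theorem inner_map_segment {E : Type*} [NormedAddCommGroup E] [InnerProductSpace ℝ E]
    (H : E →L[ℝ] E) (v d : E) (t : ℝ) :
    inner ℝ (H (v + t • d)) (v + t • d) = (1 - t) * inner ℝ (H v) v +
      t * inner ℝ (H (v + d)) (v + d) - t * (1 - t) * inner ℝ (H d) d := by
  simp only [map_add, map_smul, inner_add_left, inner_add_right, real_inner_smul_left,
    real_inner_smul_right]
  ring

theorem model_zero (hR : IsRetraction R) (hX : X ∈ Stiefel n r) : model f h R X H 0 = h X := by
  simp [model, hR.map_zero X hX]

/-- The model is strongly convex relative to the quadratic form `⟨H d, d⟩ - 2 L_h M₂ ‖d‖²`. -/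
theorem model_segment_le (hRL : HasLipschitzDifferential R M₂) (hX : X ∈ Stiefel n r)
    (hh : ConvexOn ℝ univ h) (hhL : LipschitzWith Lh h)
    (V W : tangent X) {t : ℝ} (ht0 : 0 ≤ t) (ht1 : t ≤ 1) :
    model f h R X H (V + t • (W - V)) ≤ (1 - t) * model f h R X H V + t * model f h R X H W -
      t * (1 - t) * ((1 / 2) * (inner ℝ (H (W - V)) (W - V) - 2 * Lh * M₂ * ‖W - V‖ ^ 2)) := by
  have h1 := comp_retr_weakly_convex hRL hX hh hhL V W ht0 ht1
  have h2 : W = V + (W - V) := by abel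
  generalize W - V = d at *
  subst h2
  have h3 := inner_map_segment H V d t
  have h4 : inner ℝ (rgrad f X) ((V : Mat n r) + t • (d : Mat n r)) =
      inner ℝ (rgrad f X) (V : Mat n r) + t * inner ℝ (rgrad f X) (d : Mat n r) := by
    rw [inner_add_right, real_inner_smul_right]
  have h5 : inner ℝ (rgrad f X) ((V : Mat n r) + (d : Mat n r)) =
      inner ℝ (rgrad f X) (V : Mat n r) + inner ℝ (rgrad f X) (d : Mat n r) := inner_add_right _ _ _
  simp only [model, h3, Submodule.coe_add, Submodule.coe_smul, h4, h5] at h1 ⊢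
  linarith

/-- Quadratic growth of the model at a minimizer. -/
theorem model_minimizer_growth (hRL : HasLipschitzDifferential R M₂) (hX : X ∈ Stiefel n r)
    (hh : ConvexOn ℝ univ h) (hhL : LipschitzWith Lh h) {V : tangent X}
    (hV : ∀ W, model f h R X H V ≤ model f h R X H W) (W : tangent X) :
    model f h R X H V +
      (1 / 2) * (inner ℝ (H (W - V)) (W - V) - 2 * Lh * M₂ * ‖W - V‖ ^ 2) ≤
      model f h R X H W := by
  set q := (1 / 2) * (inner ℝ (H (W - V)) (W - V) - 2 * Lh * M₂ * ‖W - V‖ ^ 2) with hq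
  -- Minimality is compared with the value at `V + t (W - V)` and divided by `t`; letting `t → 0`
  -- afterwards recovers the full constant.
  have key : ∀ t ∈ Ioo (0 : ℝ) 1, model f h R X H V + (1 - t) * q ≤ model f h R X H W := by
    intro t ht
    have h1 := model_segment_le (f := f) (H := H) hRL hX hh hhL V W ht.1.le ht.2.le
    have h2 := hV (V + t • (W - V))
    rw [← hq] at h1
    have h3 : t * (model f h R X H V + (1 - t) * q) ≤ t * model f h R X H W := by linarith
    exact le_of_mul_le_mul_left h3 ht.1
  have hlim : Tendsto (fun t : ℝ => model f h R X H V + (1 - t) * q) (𝓝[>] 0)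
      (𝓝 (model f h R X H V + (1 - 0) * q)) := by
    refine Tendsto.mono_left (Continuous.tendsto ?_ 0) nhdsWithin_le_nhds
    fun_prop
  have := le_of_tendsto hlim (Filter.mem_of_superset (Ioo_mem_nhdsGT zero_lt_one) key)
  simpa using this

/-- The model decreases along the segment from the origin to its minimizer. -/
theorem model_smul_sub_le (hRL : HasLipschitzDifferential R M₂)
    (hX : X ∈ Stiefel n r)
    (hh : ConvexOn ℝ univ h) (hhL : LipschitzWith Lh h) {V : tangent X}
    (hV : ∀ W, model f h R X H V ≤ model f h R X H W) {t : ℝ} (ht0 : 0 ≤ t) (ht1 : t ≤ 1)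
    (hq : 2 * Lh * M₂ * ‖V‖ ^ 2 ≤ inner ℝ (H V) V) :
    model f h R X H (t • V) - model f h R X H 0 ≤
      -(t * ((1 / 2) * (inner ℝ (H V) V - 2 * Lh * M₂ * ‖V‖ ^ 2))) := by
  have h1 := model_segment_le (f := f) (H := H) hRL hX hh hhL 0 V ht0 ht1
  have h2 := model_minimizer_growth hRL hX hh hhL hV 0
  simp only [zero_sub, map_neg, inner_neg_left, inner_neg_right, neg_neg, norm_neg] at h2
  simp only [sub_zero, zero_add] at h1
  have h3 : 0 ≤ t * (1 - t) * ((1 / 2) * (inner ℝ (H V) V - 2 * Lh * M₂ * ‖V‖ ^ 2)) :=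
    mul_nonneg (mul_nonneg ht0 (sub_nonneg.2 ht1)) (by linarith)
  have h4 := mul_le_mul_of_nonneg_left h2 ht0
  linarith

end Model

/-! ### Second derivatives along retraction curves. -/

section SecondOrder

variable {R : Mat n r → Mat n r → Mat n r} {X : Mat n r} {f : Mat n r → ℝ}

theorem IsRetraction.contDiff_tangent (hR : IsRetraction R) (hX : X ∈ Stiefel n r) :
    ContDiff ℝ ∞ fun ξ : tangent X => R X ξ :=
  contDiffOn_univ.1 <| hR.smooth.comp
    (contDiff_const.prodMk (tangent X).subtypeL.contDiff).contDiffOn fun ξ _ => ⟨hX, ξ.2⟩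

theorem IsRetraction.contDiff_curve (hR : IsRetraction R) (hX : X ∈ Stiefel n r)
    (ξ : tangent X) : ContDiff ℝ ∞ fun t : ℝ => R X (t • (ξ : Mat n r)) :=
  (hR.contDiff_tangent hX).comp (contDiff_id.smul_const ξ)

/-- Against a tangent vector the projection disappears. The right side makes sense for all ambient
pairs, so continuity in `X` can be stated although the tangent space varies. -/
theorem inner_rHess (f : Mat n r → ℝ) (X : Mat n r) (ξ : tangent X) :
    inner ℝ (rHess f X ξ) ξ = inner ℝ (fderiv ℝ (rgrad f) X (ξ : Mat n r)) (ξ : Mat n r) := by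
  exact Submodule.inner_orthogonalProjectionOnto_eq_of_mem_right ξ _

theorem hasDerivAt_smul_line {E : Type*} [NormedAddCommGroup E] [NormedSpace ℝ E] (ξ : E) (t : ℝ) :
    HasDerivAt (fun t : ℝ => t • ξ) ξ t := by
  simpa using (hasDerivAt_id t).smul_const ξ

theorem IsRetraction.deriv_curve_zero (hR : IsRetraction R) (hX : X ∈ Stiefel n r)
    (ξ : tangent X) : deriv (fun t : ℝ => R X (t • (ξ : Mat n r))) 0 = ξ := by
  have h := HasFDerivAt.comp_hasDerivAt_of_eq (0 : ℝ) (hR.deriv_zero X hX)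
    (hasDerivAt_smul_line ξ 0) (zero_smul ℝ ξ).symm
  exact h.deriv

/-- The curve stays on the manifold, so its velocity is tangent and the Euclidean gradient may be
replaced by `rgrad`, whose derivative yields the Hessian. -/
theorem hasDerivAt_comp_curve (hf : Differentiable ℝ f) (hR : IsRetraction R)
    (hX : X ∈ Stiefel n r) (ξ : tangent X) (t : ℝ) :
    HasDerivAt (fun t : ℝ => f (R X (t • (ξ : Mat n r))))
      (inner ℝ (rgrad f (R X (t • (ξ : Mat n r))))
        (deriv (fun t : ℝ => R X (t • (ξ : Mat n r))) t)) t := by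
  have hc := (contDiff_infty_iff_deriv.1 (hR.contDiff_curve hX ξ)).1 t
  have hmem := mem_tangent_of_hasDerivAt hc.hasDerivAt
    fun u => hR.mem X hX _ ((tangent X).smul_mem u ξ.2)
  rw [inner_rgrad f hmem]
  refine ((hf _).hasFDerivAt.comp_hasDerivAt t hc.hasDerivAt).congr_deriv ?_
  rw [gradient, InnerProductSpace.toDual_symm_apply]

/-- For a second-order retraction, the second derivative of `f` along the retraction curves is
the Riemannian Hessian. -/
theorem hasDerivAt_deriv_comp_curve (hf : ContDiff ℝ 2 f) (hR : IsRetraction R)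
    (hR₂ : IsSecondOrder R) (hX : X ∈ Stiefel n r) (ξ : tangent X) :
    HasDerivAt (deriv fun t : ℝ => f (R X (t • (ξ : Mat n r)))) (inner ℝ (rHess f X ξ) ξ) 0 := by
  have hfun : (deriv fun t : ℝ => f (R X (t • (ξ : Mat n r)))) = fun t =>
      inner ℝ (rgrad f (R X (t • (ξ : Mat n r))))
        (deriv (fun t : ℝ => R X (t • (ξ : Mat n r))) t) := funext fun t =>
    (hasDerivAt_comp_curve (hf.differentiable (by norm_num)) hR hX ξ t).deriv
  rw [hfun]
  set c : ℝ → Mat n r := fun t => R X (t • (ξ : Mat n r)) with hc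
  have hsm := contDiff_infty_iff_deriv.1 (hR.contDiff_curve hX ξ)
  have hc0 : c 0 = X := by simp [hc, hR.map_zero X hX]
  have hc1 : deriv c 0 = ξ := hR.deriv_curve_zero hX ξ
  have hd0 : HasDerivAt c (ξ : Mat n r) 0 := hc1 ▸ (hsm.1 0).hasDerivAt
  have hd1 : HasDerivAt (deriv c) (deriv (deriv c) 0) 0 :=
    ((contDiff_infty_iff_deriv.1 hsm.2).1 0).hasDerivAt
  have h2 := hR₂ X hX ξ ξ.2
  rw [iteratedDeriv_succ, iteratedDeriv_one] at h2
  have hrg : HasDerivAt (fun t => rgrad f (c t)) (fderiv ℝ (rgrad f) X (ξ : Mat n r)) 0 :=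
    HasFDerivAt.comp_hasDerivAt_of_eq (0 : ℝ)
      (((contDiff_rgrad hf).differentiable one_ne_zero) X).hasFDerivAt hd0 hc0.symm
  refine (hrg.inner ℝ hd1).congr_deriv ?_
  rw [hc0, hc1, inner_rHess]
  -- The Riemannian gradient is tangent and the initial acceleration is normal: here the
  -- second-order property is used.
  have h3 : inner ℝ (rgrad f X) (deriv (deriv c) 0) = 0 := by
    have h4 := Submodule.inner_orthogonalProjectionOnto_eq_of_mem_left (K := tangent X)
      ⟨rgrad f X, rgrad_mem hX f⟩ (deriv (deriv c) 0)
    rw [h2] at h4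
    simpa using h4.symm
  rw [h3, zero_add]

/-- Both sides are the second derivative of `t ↦ f (R_X(tξ))` at `0`. -/
theorem inner_pullbackHess (hf : ContDiff ℝ 2 f) (hR : IsRetraction R)
    (hR₂ : IsSecondOrder R) (hX : X ∈ Stiefel n r) (ξ : tangent X) :
    inner ℝ (pullbackHess f R X ξ) ξ = inner ℝ (rHess f X ξ) ξ := by
  set G : tangent X → ℝ := fun ξ => f (R X ξ) with hG
  have hG2 : ContDiff ℝ 2 G :=
    hf.comp ((hR.contDiff_tangent hX).of_le (WithTop.coe_le_coe.2 (le_top : (2 : ℕ∞) ≤ ⊤)))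
  have hGd : ∀ t : ℝ, HasDerivAt (fun t : ℝ => G (t • ξ)) (inner ℝ (gradient G (t • ξ)) ξ) t :=
    fun t => by
      refine (((hG2.differentiable (by norm_num)) _).hasFDerivAt.comp_hasDerivAt t
        (hasDerivAt_smul_line ξ t)).congr_deriv ?_
      rw [gradient, InnerProductSpace.toDual_symm_apply]
  have h1 : HasDerivAt (fun t : ℝ => gradient G (t • ξ)) (pullbackHess f R X ξ) 0 :=
    HasFDerivAt.comp_hasDerivAt_of_eq (0 : ℝ)
      (((contDiff_gradient hG2).differentiable one_ne_zero) 0).hasFDerivAt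
      (hasDerivAt_smul_line ξ 0) (zero_smul ℝ ξ).symm
  have h2 := h1.inner ℝ (hasDerivAt_const (0 : ℝ) ξ)
  have h3 := hasDerivAt_deriv_comp_curve hf hR hR₂ hX ξ
  have h4 : (deriv fun t : ℝ => f (R X (t • (ξ : Mat n r)))) =
      fun t => inner ℝ (gradient G (t • ξ)) ξ := funext fun t => (hGd t).deriv
  rw [h4] at h3
  simpa using h2.unique h3

end SecondOrder

/-! ### Rayleigh quotient bounds. -/

section Eigenvalue

variable {E : Type*} [NormedAddCommGroup E] [InnerProductSpace ℝ E]

theorem bddBelow_rayleigh (H : E →L[ℝ] E) :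
    BddBelow (range fun v : Metric.sphere (0 : E) 1 => inner ℝ (H v) (v : E)) := by
  refine ⟨-‖H‖, ?_⟩
  rintro _ ⟨v, rfl⟩
  have hv : ‖(v : E)‖ = 1 := by simp
  have h1 := abs_real_inner_le_norm (H v) (v : E)
  have h2 := H.le_opNorm (v : E)
  rw [hv, mul_one] at h1 h2
  exact (neg_le_neg h2).trans (abs_le.1 h1).1 |>.trans le_rfl

theorem lambdaMin_mul_le (H : E →L[ℝ] E) (v : E) : lambdaMin H * ‖v‖ ^ 2 ≤ inner ℝ (H v) v := by
  rcases eq_or_ne v 0 with rfl | hv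
  · simp
  have hn : ‖v‖ ≠ 0 := norm_ne_zero_iff.2 hv
  have hu : ‖v‖⁻¹ • v ∈ Metric.sphere (0 : E) 1 := by
    rw [mem_sphere_zero_iff_norm, norm_smul, norm_inv, norm_norm, inv_mul_cancel₀ hn]
  have h := ciInf_le (bddBelow_rayleigh H) ⟨_, hu⟩
  simp only [map_smul, real_inner_smul_left, real_inner_smul_right] at h
  have h2 := mul_le_mul_of_nonneg_right h (sq_nonneg ‖v‖)
  refine h2.trans (le_of_eq ?_)
  field_simp

/-- The nonzero vector keeps the unit sphere nonempty; on the zero space the infimum is the default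
value `0` and the bound fails for positive `μ`. In a run, a search direction serves as this vector.
-/
theorem le_lambdaMin {H : E →L[ℝ] E} {v : E} (hv : v ≠ 0) {μ : ℝ}
    (h : ∀ w, μ * ‖w‖ ^ 2 ≤ inner ℝ (H w) w) : μ ≤ lambdaMin H := by
  have hn : ‖v‖ ≠ 0 := norm_ne_zero_iff.2 hv
  have : Nonempty (Metric.sphere (0 : E) 1) := ⟨⟨‖v‖⁻¹ • v, by
    rw [mem_sphere_zero_iff_norm, norm_smul, norm_inv, norm_norm, inv_mul_cancel₀ hn]⟩⟩
  refine le_ciInf fun w => ?_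
  have hw : ‖(w : E)‖ = 1 := by simp
  simpa [hw] using h w

end Eigenvalue

/-! ### Uniform estimates near a point of the manifold. -/

section Local

variable {R : Mat n r → Mat n r → Mat n r} {f : Mat n r → ℝ} {Xs : Mat n r}

/-- Lower bounds on the Hessian persist near a point of the manifold. -/
theorem eventually_le_inner_rHess (hf : ContDiff ℝ 2 f) {μ ν : ℝ} (hμ : μ < ν)
    (h : ∀ ξ : tangent Xs, ν * ‖ξ‖ ^ 2 ≤ inner ℝ (rHess f Xs ξ) ξ) :
    ∀ᶠ X in 𝓝 Xs, ∀ ξ : tangent X, μ * ‖ξ‖ ^ 2 ≤ inner ℝ (rHess f X ξ) ξ := by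
  set q : Mat n r × Mat n r → ℝ := fun p => inner ℝ (fderiv ℝ (rgrad f) p.1 p.2) p.2 with hq
  have hqc : Continuous q := by
    have h1 : Continuous fun X => fderiv ℝ (rgrad f) X :=
      (contDiff_rgrad hf).continuous_fderiv one_ne_zero
    exact ((h1.comp continuous_fst).clm_apply continuous_snd).inner continuous_snd
  -- Compactness of the unit sphere turns this into a claim near each pair `(Xs, v)`. If `v` is not
  -- tangent at `Xs`, closedness of the tangency condition makes it vacuous nearby.
  have key : ∀ᶠ X in 𝓝 Xs, ∀ v ∈ Metric.sphere (0 : Mat n r) 1, v ∈ tangent X → μ < q (X, v) := by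
    refine (isCompact_sphere (0 : Mat n r) 1).eventually_forall_of_forall_eventually fun v hv => ?_
    by_cases hvt : v ∈ tangent Xs
    · have h1 : μ < q (Xs, v) := by
        have h2 := h ⟨v, hvt⟩
        rw [inner_rHess] at h2
        have hv1 : ‖v‖ = 1 := by simpa using hv
        simp only [Submodule.coe_norm, hv1] at h2
        simp only [hq]
        linarith
      filter_upwards [hqc.continuousAt.eventually_const_lt h1] with p hp _ using hp
    · have h1 : {p : Mat n r × Mat n r | p.2 ∈ tangent p.1}ᶜ ∈ 𝓝 (Xs, v) :=
        isClosed_setOf_mem_tangent.isOpen_compl.mem_nhds hvt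
      filter_upwards [h1] with p hp hp' using absurd hp' hp
  filter_upwards [key] with X hX ξ
  rw [inner_rHess]
  rcases eq_or_ne ξ 0 with rfl | hξ
  · simp
  have hn : ‖ξ‖ ≠ 0 := norm_ne_zero_iff.2 hξ
  have hu : ‖ξ‖⁻¹ • (ξ : Mat n r) ∈ Metric.sphere (0 : Mat n r) 1 := by
    rw [mem_sphere_zero_iff_norm, norm_smul, norm_inv, norm_norm, Submodule.coe_norm,
      inv_mul_cancel₀ (by simpa using hn)]
  have h1 := hX _ hu ((tangent X).smul_mem _ ξ.2)
  simp only [hq, map_smul, real_inner_smul_left, real_inner_smul_right] at h1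
  have h2 := mul_le_mul_of_nonneg_right h1.le (sq_nonneg ‖ξ‖)
  refine h2.trans (le_of_eq ?_)
  field_simp

/-- The mean value inequality is applied twice; `C / 2` would be sharp, but only smallness matters.
-/
theorem abs_sub_taylor_two_le {g g₁ g₂ : ℝ → ℝ} {C : ℝ}
    (h₁ : ∀ t ∈ Icc (0 : ℝ) 1, HasDerivAt g (g₁ t) t)
    (h₂ : ∀ t ∈ Icc (0 : ℝ) 1, HasDerivAt g₁ (g₂ t) t)
    (hC : ∀ t ∈ Icc (0 : ℝ) 1, |g₂ t - g₂ 0| ≤ C) :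
    |g 1 - g 0 - g₁ 0 - (1 / 2) * g₂ 0| ≤ C := by
  have hC0 : 0 ≤ C := (abs_nonneg _).trans (hC 0 (by simp))
  have s1 : ∀ t ∈ Icc (0 : ℝ) 1, |g₁ t - g₁ 0 - t * g₂ 0| ≤ C := by
    intro t ht
    have hd : ∀ u ∈ Icc (0 : ℝ) 1,
        HasDerivWithinAt (fun u => g₁ u - u * g₂ 0) (g₂ u - g₂ 0) (Icc 0 1) u := fun u hu =>
      (((h₂ u hu).fun_sub ((hasDerivAt_id u).mul_const (g₂ 0))).congr_deriv
        (by simp)).hasDerivWithinAt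
    have := norm_image_sub_le_of_norm_deriv_le_segment' hd
      (fun u hu => hC u (Ico_subset_Icc_self hu)) t ht
    simp only [zero_mul, sub_zero, Real.norm_eq_abs] at this
    rw [sub_right_comm] at this
    exact this.trans (mul_le_of_le_one_right hC0 ht.2)
  have hd : ∀ u ∈ Icc (0 : ℝ) 1, HasDerivWithinAt
      (fun u => g u - u * g₁ 0 - u ^ 2 * ((1 / 2) * g₂ 0)) (g₁ u - g₁ 0 - u * g₂ 0) (Icc 0 1) u :=
    fun u hu => by
      refine ((((h₁ u hu).fun_sub ((hasDerivAt_id u).mul_const (g₁ 0))).fun_sub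
        ((hasDerivAt_pow 2 u).mul_const ((1 / 2) * g₂ 0))).congr_deriv ?_).hasDerivWithinAt
      norm_num
      ring
  have := norm_image_sub_le_of_norm_deriv_le_segment' hd
      (fun u hu => s1 u (Ico_subset_Icc_self hu)) 1 (by simp)
  rw [Real.norm_eq_abs] at this
  convert this using 2 <;> ring

/-- Second-order Taylor expansion of `f ∘ R`, uniform near a point of the manifold. -/
theorem exists_taylor_two_retr (hf : ContDiff ℝ 2 f) (hR : IsRetraction R)
    (hR₂ : IsSecondOrder R) (hXs : Xs ∈ Stiefel n r) {ε : ℝ} (hε : 0 < ε) :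
    ∃ τ > 0, ∀ X ∈ Stiefel n r, ‖X - Xs‖ < τ → ∀ V : tangent X, ‖V‖ < τ →
      |f (R X V) - f X - inner ℝ (rgrad f X) (V : Mat n r) - (1 / 2) * inner ℝ (rHess f X V) V| ≤
        ε * ‖V‖ ^ 2 := by
  set Φ : Mat n r × Mat n r → ℝ := fun p => f (R p.1 p.2) with hΦ
  have hmem : (Xs, (0 : Mat n r)) ∈ tangentBundle n r := ⟨hXs, zero_mem _⟩
  have hΦ2 : ContDiffWithinAt ℝ (1 + 1) Φ (tangentBundle n r) (Xs, 0) := by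
    have := hf.comp_contDiffOn (hR.smooth.of_le (m := 2) (WithTop.coe_le_coe.2 (le_top : (2 : ℕ∞) ≤ ⊤)))
    rw [one_add_one_eq_two]
    exact this _ hmem
  -- The tangent bundle is not open, so `Φ'` and `Φ''` are merely some derivatives within it. They
  -- are evaluated only along lines in the fibres, where one-variable derivatives determine their
  -- values.
  obtain ⟨u, hu, -, Φ', hΦ', hΦ'1⟩ := (contDiffWithinAt_succ_iff_hasFDerivWithinAt (by simp)).1 hΦ2
  rw [insert_eq_of_mem hmem] at hu
  obtain ⟨w, hw, -, Φ'', hΦ'', hΦ''0⟩ :=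
    (contDiffWithinAt_succ_iff_hasFDerivWithinAt (n := 0) (by simp)).1 (by simpa using hΦ'1)
  have hxu : (Xs, (0 : Mat n r)) ∈ u := mem_of_mem_nhdsWithin hmem hu
  rw [insert_eq_of_mem hxu] at hw
  have hcont := hΦ''0.continuousWithinAt
  have hw' : w ∈ 𝓝[tangentBundle n r] (Xs, (0 : Mat n r)) := nhdsWithin_le_of_mem hu hw
  have hwΦ : {p | ‖Φ'' p - Φ'' (Xs, 0)‖ < ε / 2} ∈ 𝓝[tangentBundle n r] (Xs, (0 : Mat n r)) := by
    have h1 : {p | ‖Φ'' p - Φ'' (Xs, 0)‖ < ε / 2} ∈ 𝓝[w] (Xs, (0 : Mat n r)) := by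
      have := Metric.tendsto_nhds.1 hcont (ε / 2) (half_pos hε)
      simp only [dist_eq_norm] at this
      exact this
    exact nhdsWithin_le_of_mem hw' h1
  obtain ⟨τ, hτ, hball⟩ := Metric.mem_nhdsWithin_iff.1 (inter_mem (inter_mem hu hw') hwΦ)
  refine ⟨τ / 2, half_pos hτ, fun X hX hXτ V hVτ => ?_⟩
  -- An open interval around `[0, 1]` turns derivatives within the bundle into ordinary derivatives
  -- in `t`; the halved radius pays for `|t| < 2`.
  have hline : ∀ t ∈ Ioo (-2 : ℝ) 2, (X, t • (V : Mat n r)) ∈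
      Metric.ball (Xs, (0 : Mat n r)) τ ∩ tangentBundle n r := by
    intro t ht
    refine ⟨?_, hX, (tangent X).smul_mem t V.2⟩
    rw [mem_ball_iff_norm, Prod.mk_sub_mk, Prod.norm_mk, sub_zero, max_lt_iff, norm_smul]
    refine ⟨by linarith, ?_⟩
    have h1 : ‖t‖ < 2 := abs_lt.2 ht
    have h2 : ‖(V : Mat n r)‖ < τ / 2 := hVτ
    nlinarith [norm_nonneg t, norm_nonneg (V : Mat n r)]
  have hd : ∀ t : ℝ, HasDerivAt (fun t : ℝ => (X, t • (V : Mat n r))) (0, (V : Mat n r)) t :=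
    fun t => (hasDerivAt_const t X).prodMk (hasDerivAt_smul_line _ t)
  have hIoo : ∀ t ∈ Ioo (-2 : ℝ) 2, Ioo (-2 : ℝ) 2 ∈ 𝓝 t := fun t ht => isOpen_Ioo.mem_nhds ht
  set g : ℝ → ℝ := fun t => f (R X (t • (V : Mat n r))) with hg
  set v : Mat n r × Mat n r := (0, (V : Mat n r)) with hv
  have hvn : ‖v‖ = ‖V‖ := by simp [hv]
  have hg1 : ∀ t ∈ Ioo (-2 : ℝ) 2, HasDerivAt g (Φ' (X, t • (V : Mat n r)) v) t := fun t ht => by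
    have h1 := ((hΦ' _ (hball (hline t ht)).1.1).comp_hasDerivWithinAt t (hd t).hasDerivWithinAt
      (fun s hs => (hball (hline s hs)).1.1)).hasDerivAt (hIoo t ht)
    exact h1
  have hg2 : ∀ t ∈ Ioo (-2 : ℝ) 2, HasDerivAt (fun t : ℝ => Φ' (X, t • (V : Mat n r)) v)
      (Φ'' (X, t • (V : Mat n r)) v v) t := fun t ht => by
    have h1 := ((hΦ'' _ (hball (hline t ht)).1.2).comp_hasDerivWithinAt t (hd t).hasDerivWithinAt
      (fun s hs => (hball (hline s hs)).1.2)).hasDerivAt (hIoo t ht)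
    exact ((ContinuousLinearMap.apply ℝ ℝ v).hasFDerivAt.comp_hasDerivAt t h1)
  have h0 : (0 : ℝ) ∈ Ioo (-2 : ℝ) 2 := by norm_num
  have hIcc : ∀ t ∈ Icc (0 : ℝ) 1, t ∈ Ioo (-2 : ℝ) 2 := fun t ht =>
    ⟨by linarith [ht.1], by linarith [ht.2]⟩
  have htay := abs_sub_taylor_two_le (fun t ht => hg1 t (hIcc t ht)) (fun t ht => hg2 t (hIcc t ht))
    (C := ε * ‖V‖ ^ 2) fun t ht => by
      have a1 := (hball (hline t (hIcc t ht))).2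
      have a2 := (hball (hline 0 h0)).2
      simp only [mem_ofPred_eq] at a1 a2
      have a3 : ‖Φ'' (X, t • (V : Mat n r)) - Φ'' (X, (0 : ℝ) • (V : Mat n r))‖ ≤ ε := by
        have := norm_sub_le_norm_sub_add_norm_sub (Φ'' (X, t • (V : Mat n r))) (Φ'' (Xs, 0))
          (Φ'' (X, (0 : ℝ) • (V : Mat n r)))
        rw [norm_sub_rev (Φ'' (Xs, 0))] at this
        linarith
      have a4 := (Φ'' (X, t • (V : Mat n r)) - Φ'' (X, (0 : ℝ) • (V : Mat n r))).le_opNorm₂ v v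
      simp only [sub_apply, Real.norm_eq_abs, hvn] at a4
      refine a4.trans ?_
      rw [mul_assoc, ← sq]
      exact mul_le_mul_of_nonneg_right a3 (sq_nonneg _)
  have e0 : g 0 = f X := by simp [hg, hR.map_zero X hX]
  have e1 : g 1 = f (R X V) := by simp [hg]
  have e2 : Φ' (X, (0 : ℝ) • (V : Mat n r)) v = inner ℝ (rgrad f X) (V : Mat n r) := by
    have := (hg1 0 h0).unique
      (hasDerivAt_comp_curve (hf.differentiable (by norm_num)) hR hX V 0)
    rw [this, hR.deriv_curve_zero hX V, zero_smul, hR.map_zero X hX]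
  have e3 : Φ'' (X, (0 : ℝ) • (V : Mat n r)) v v = inner ℝ (rHess f X V) V := by
    have h1 := hasDerivAt_deriv_comp_curve hf hR hR₂ hX V
    refine (hg2 0 h0).unique (h1.congr_of_eventuallyEq ?_)
    filter_upwards [hIoo 0 h0] with t ht using (hg1 t ht).deriv.symm
  rw [e0, e1, e2, e3] at htay
  exact htay

end Local

/-! ### Local surjectivity of the retraction. -/

section LocalInverse

variable {R : Mat n r → Mat n r → Mat n r} {M₂ : ℝ} {Xs : Mat n r}

theorem norm_le_of_mem_stiefel {X : Mat n r} (hX : X ∈ Stiefel n r) : ‖X‖ ≤ r + 1 := by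
  have h := norm_sq_of_mem_stiefel hX
  have hr : (0 : ℝ) ≤ r := Nat.cast_nonneg r
  nlinarith [norm_nonneg X]

theorem tangentProj_eq_zero {X D : Mat n r} (hX : X ∈ Stiefel n r)
    (h : (tangent X).orthogonalProjectionOnto D = 0) : tangentProj X D = 0 := by
  have hm := tangentProj_mem hX D
  have h1 := inner_tangentProj X D hm
  have h2 := Submodule.inner_orthogonalProjectionOnto_eq_of_mem_right
    (K := tangent X) ⟨_, hm⟩ D
  rw [h] at h2
  rw [← inner_self_eq_zero (𝕜 := ℝ), h1]
  simpa using h2.symm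

/-- Every point `Xs` of the manifold is reached by the retraction at each nearby point `X`, along a
tangent vector of size comparable to `‖X - Xs‖`. -/
theorem exists_retr_eq (hR : IsRetraction R) (hRL : HasLipschitzDifferential R M₂) (hM : 0 < M₂)
    (hXs : Xs ∈ Stiefel n r) :
    ∃ τ > 0, ∀ X ∈ Stiefel n r, ‖X - Xs‖ < τ →
      ∃ ξ : tangent X, R X ξ = Xs ∧ ‖ξ‖ ≤ 2 * ‖X - Xs‖ := by
  have hr : (0 : ℝ) < r + 1 := by positivity
  -- The first radius keeps `2‖e‖` within `1 / (4 M₂)`, where `R_X` is close to a translation. The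
  -- second meets the injectivity condition, as `‖X‖ ≤ r + 1` and the distances there sum to at most
  -- `7 ‖X - Xs‖`.
  refine ⟨min (1 / (8 * M₂)) (1 / (7 * (r + 1))), by positivity, fun X hX hd => ?_⟩
  have hd1 : ‖X - Xs‖ * (8 * M₂) < 1 := by
    have := hd.trans_le (min_le_left _ _)
    rwa [lt_div_iff₀ (by positivity)] at this
  have hd2 : ‖X - Xs‖ * (7 * (r + 1)) < 1 := by
    have := hd.trans_le (min_le_right _ _)
    rwa [lt_div_iff₀ (by positivity)] at this
  set Q := (tangent X).orthogonalProjectionOnto with hQ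
  have hQn : ∀ v, ‖Q v‖ ≤ ‖v‖ := fun v => by
    simpa using (Q.le_opNorm v).trans (mul_le_mul_of_nonneg_right
      (Submodule.orthogonalProjectionOnto_norm_le (tangent X)) (norm_nonneg v))
  have hQid : ∀ V : tangent X, Q (V : Mat n r) = V := fun V =>
    Submodule.orthogonalProjectionOnto_mem_subspace_eq_self V
  -- On the ball of radius `1 / (4 M₂)` this map is `½`-close to the identity, hence covers a ball
  -- of half the radius around `0`. Solving `ψ ξ = Q (Xs - X)` matches only tangential parts;
  -- injectivity of the projection on the manifold then gives `R X ξ = Xs`.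
  set ψ : tangent X → tangent X := fun ξ => Q (R X ξ - X) with hψ
  have happ : ApproximatesLinearOn ψ (ContinuousLinearMap.id ℝ (tangent X))
      (Metric.closedBall 0 (1 / (4 * M₂))) (1 / 2) := by
    intro V hV W hW
    rw [mem_closedBall_zero_iff] at hV hW
    have h1 := hRL.norm_retr_sub_retr_le hR hM.le hX hV hW
    have h2 : ψ V - ψ W - (ContinuousLinearMap.id ℝ (tangent X)) (V - W) =
        Q (R X V - R X W - ((V : Mat n r) - W)) := by
      simp only [hψ, map_sub, hQid, ContinuousLinearMap.id_apply]
      abel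
    rw [h2]
    refine (hQn _).trans (h1.trans (le_of_eq ?_))
    push_cast
    field_simp
    norm_num
  have hψ0 : ψ 0 = 0 := by simp [hψ, hR.map_zero X hX]
  let inv : (ContinuousLinearMap.id ℝ (tangent X)).NonlinearRightInverse :=
    { toFun := id
      nnnorm := 1
      bound' := fun y => by simp
      right_inv' := fun y => rfl }
  set e := Q (Xs - X) with he
  have hen : ‖e‖ ≤ ‖X - Xs‖ := by
    rw [norm_sub_rev]
    exact hQn _
  have hsub : Metric.closedBall (0 : tangent X) (2 * ‖e‖) ⊆
      Metric.closedBall 0 (1 / (4 * M₂)) := by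
    refine Metric.closedBall_subset_closedBall ?_
    rw [le_div_iff₀ (by positivity)]
    nlinarith
  have hsurj := happ.surjOn_closedBall_of_nonlinearRightInverse inv
    (by positivity : 0 ≤ 2 * ‖e‖) hsub
  have hmem : e ∈ Metric.closedBall (ψ 0) (((inv.nnnorm : ℝ)⁻¹ - ((1 / 2 : ℝ≥0) : ℝ)) *
      (2 * ‖e‖)) := by
    rw [hψ0, mem_closedBall_zero_iff]
    have : (inv.nnnorm : ℝ) = 1 := rfl
    rw [this]
    push_cast
    linarith
  obtain ⟨ξ, hξ, hξe⟩ := hsurj hmem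
  rw [mem_closedBall_zero_iff] at hξ
  have hξX : ‖ξ‖ ≤ 2 * ‖X - Xs‖ := by linarith
  refine ⟨ξ, ?_, hξX⟩
  have hproj : Q (R X ξ - Xs) = 0 := by
    have h1 : R X ξ - Xs = (R X ξ - X) - (Xs - X) := by abel
    rw [h1, map_sub]
    exact sub_eq_zero.2 hξe
  refine eq_of_tangentProj_sub_eq_zero (hR.mem X hX ξ ξ.2) hXs (tangentProj_eq_zero hX hproj) ?_
  have h1 := hRL.norm_retr_sub_sub_le hR hX ξ
  have h2 : ‖R X ξ - Xs‖ ≤ ‖R X ξ - X - ξ‖ + ‖ξ‖ + ‖X - Xs‖ := by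
    have h3 : R X ξ - Xs = (R X ξ - X - ξ) + ξ + (X - Xs) := by abel
    conv_lhs => rw [h3]
    refine (norm_add_le _ _).trans ?_
    gcongr
    exact norm_add_le _ _
  have h3 : M₂ * ‖ξ‖ ^ 2 ≤ ‖ξ‖ := by
    have : M₂ * ‖ξ‖ ≤ 1 := by nlinarith
    nlinarith [norm_nonneg ξ]
  have h4 : ‖R X ξ - Xs‖ + 2 * ‖Xs - X‖ ≤ 7 * ‖X - Xs‖ := by
    rw [norm_sub_rev Xs X]
    linarith
  calc ‖X‖ * (‖R X ξ - Xs‖ + 2 * ‖Xs - X‖) ≤ (r + 1) * (7 * ‖X - Xs‖) :=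
        mul_le_mul (norm_le_of_mem_stiefel hX) h4 (by positivity) hr.le
    _ < 2 := by linarith

end LocalInverse

/-- The standing assumptions on the objective `f + h` and on the retraction. -/
structure IsProblem (f h : Mat n r → ℝ) (R : Mat n r → Mat n r → Mat n r) (L Lh : ℝ≥0)
    (M₂ : ℝ) : Prop where
  contDiff : ContDiff ℝ 2 f
  lipschitz_gradient : LipschitzWith L (gradient f)
  convex : ConvexOn ℝ univ h
  lipschitz : LipschitzWith Lh h
  Lh_pos : 0 < (Lh : ℝ)
  retr : IsRetraction R
  second_order : IsSecondOrder R
  M₂_pos : 0 < M₂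
  retr_lipschitz : HasLipschitzDifferential R M₂

theorem inner_map_smul_smul {E : Type*} [NormedAddCommGroup E] [InnerProductSpace ℝ E]
    (H : E →L[ℝ] E) (α : ℝ) (v : E) :
    inner ℝ (H (α • v)) (α • v) = α ^ 2 * inner ℝ (H v) v := by
  rw [map_smul, real_inner_smul_left, real_inner_smul_right]
  ring

theorem inner_regularize {X : Mat n r} (H : tangent X →L[ℝ] tangent X) (s : ℝ) (V : tangent X) :
    inner ℝ (regularize H s V) V = inner ℝ (H V) V + s * ‖V‖ ^ 2 := by
  rw [← real_inner_self_eq_norm_sq V, ← real_inner_smul_left, ← inner_add_left]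
  rfl

/-! ### Uniform bounds, acceptance criteria and the unit step. -/

namespace IsProblem

variable {f h : Mat n r → ℝ} {R : Mat n r → Mat n r → Mat n r} {L Lh : ℝ≥0} {M₂ : ℝ}

theorem mul_pos (hp : IsProblem f h R L Lh M₂) : 0 < (Lh : ℝ) * M₂ :=
  _root_.mul_pos hp.Lh_pos hp.M₂_pos

theorem differentiable (hp : IsProblem f h R L Lh M₂) : Differentiable ℝ f :=
  hp.contDiff.differentiable (by norm_num)

theorem exists_bound (hp : IsProblem f h R L Lh M₂) :
    ∃ C : ℝ, 0 ≤ C ∧ ∀ X ∈ Stiefel n r, ‖gradient f X‖ ≤ C ∧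
      ∀ V : tangent X, -C * ‖V‖ ^ 2 ≤ inner ℝ (rHess f X V) V := by
  obtain ⟨C₁, h₁⟩ := isCompact_stiefel.exists_bound_of_continuousOn
    (contDiff_gradient hp.contDiff).continuous.continuousOn
  obtain ⟨C₂, h₂⟩ := (isCompact_stiefel (n := n) (r := r)).exists_bound_of_continuousOn
    ((contDiff_rgrad hp.contDiff).continuous_fderiv one_ne_zero).continuousOn
  refine ⟨max 0 (max C₁ C₂), le_max_left _ _, fun X hX =>
    ⟨(h₁ X hX).trans ((le_max_left _ _).trans (le_max_right _ _)), fun V => ?_⟩⟩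
  rw [inner_rHess]
  have a1 := abs_real_inner_le_norm (fderiv ℝ (rgrad f) X (V : Mat n r)) (V : Mat n r)
  have a2 := (fderiv ℝ (rgrad f) X).le_opNorm (V : Mat n r)
  have a3 : ‖fderiv ℝ (rgrad f) X‖ ≤ max 0 (max C₁ C₂) :=
    (h₂ X hX).trans ((le_max_right _ _).trans (le_max_right _ _))
  have a4 : ‖fderiv ℝ (rgrad f) X (V : Mat n r)‖ * ‖(V : Mat n r)‖ ≤
      max 0 (max C₁ C₂) * ‖V‖ ^ 2 := by
    calc _ ≤ (‖fderiv ℝ (rgrad f) X‖ * ‖(V : Mat n r)‖) * ‖(V : Mat n r)‖ :=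
          mul_le_mul_of_nonneg_right a2 (norm_nonneg _)
      _ ≤ (max 0 (max C₁ C₂) * ‖(V : Mat n r)‖) * ‖(V : Mat n r)‖ := by gcongr
      _ = _ := by rw [Submodule.coe_norm]; ring
  linarith [(abs_le.1 a1).1]

theorem norm_retr_sub_le (hp : IsProblem f h R L Lh M₂) {X : Mat n r} (hX : X ∈ Stiefel n r)
    (V : tangent X) : ‖R X V - X‖ ≤ ‖V‖ + M₂ * ‖V‖ ^ 2 := by
  have h1 := hp.retr_lipschitz.norm_retr_sub_sub_le hp.retr hX V
  have h2 : R X V - X = (R X V - X - V) + V := by abel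
  rw [h2]
  refine (norm_add_le _ _).trans ?_
  rw [Submodule.coe_norm] at h1 ⊢
  linarith

/-- Search directions are uniformly bounded. -/
theorem exists_direction_bound (hp : IsProblem f h R L Lh M₂) :
    ∃ B : ℝ, 0 ≤ B ∧ ∀ X ∈ Stiefel n r, ∀ (H : tangent X →L[ℝ] tangent X) (V : tangent X),
      (∀ W, model f h R X H V ≤ model f h R X H W) →
      3 * Lh * M₂ * ‖V‖ ^ 2 ≤ inner ℝ (H V) V → ‖V‖ ≤ B := by
  obtain ⟨C, hC0, hC⟩ := hp.exists_bound
  have hLM := hp.mul_pos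
  refine ⟨2 * (C + Lh) / (Lh * M₂), by positivity, fun X hX H V hmin hq => ?_⟩
  rw [le_div_iff₀ hLM]
  -- Of the quadratic term `(3/2) L_h M₂ ‖V‖²`, the variation of `h` consumes `L_h (‖V‖ + M₂ ‖V‖²)`.
  -- What remains is `½ L_h M₂ ‖V‖² ≤ (C + L_h) ‖V‖`.
  have h0 := hmin 0
  rw [model_zero hp.retr hX, model, inner_rgrad f V.2] at h0
  have h1 := (abs_le.1 (abs_real_inner_le_norm (gradient f X) (V : Mat n r))).1
  have h2 := hp.lipschitz.norm_sub_le (R X V) X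
  rw [Real.norm_eq_abs] at h2
  have h3 := mul_le_mul_of_nonneg_left (hp.norm_retr_sub_le hX V) hp.Lh_pos.le
  have h4 := mul_le_mul_of_nonneg_right (hC X hX).1 (norm_nonneg V)
  rw [← Submodule.coe_norm] at h1
  have h5 := (abs_le.1 h2).1
  rcases eq_or_lt_of_le (norm_nonneg V) with hv | hv
  · rw [← hv, zero_mul]
    positivity
  · have h6 : ‖V‖ * (‖V‖ * (Lh * M₂)) ≤ ‖V‖ * (2 * (C + Lh)) := by nlinarith
    exact le_of_mul_le_mul_left h6 hv

/-- The smooth part is bounded above by its linearization plus a quadratic term. -/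
theorem exists_upper_bound (hp : IsProblem f h R L Lh M₂) {B : ℝ} (hB : 0 ≤ B) :
    ∃ C : ℝ, 0 ≤ C ∧ ∀ X ∈ Stiefel n r, ∀ V : tangent X, ‖V‖ ≤ B →
      f (R X V) ≤ f X + inner ℝ (rgrad f X) (V : Mat n r) + C * ‖V‖ ^ 2 := by
  obtain ⟨C, hC0, hC⟩ := hp.exists_bound
  have hM := hp.M₂_pos
  refine ⟨C * M₂ + L * (1 + M₂ * B) ^ 2, by positivity, fun X hX V hV => ?_⟩
  have h1 := le_add_inner_gradient hp.differentiable hp.lipschitz_gradient X (R X V)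
  have h2 : R X V - X = (V : Mat n r) + (R X V - X - V) := by abel
  have h3 : inner ℝ (gradient f X) (R X V - X) = inner ℝ (rgrad f X) (V : Mat n r) +
      inner ℝ (gradient f X) (R X V - X - V) := by
    conv_lhs => rw [h2]
    rw [inner_add_right, inner_rgrad f V.2]
  have h4 := real_inner_le_norm (gradient f X) (R X V - X - V)
  have h5 : ‖gradient f X‖ * ‖R X V - X - V‖ ≤ C * (M₂ * ‖V‖ ^ 2) :=
    mul_le_mul (hC X hX).1 (hp.retr_lipschitz.norm_retr_sub_sub_le hp.retr hX V)
      (norm_nonneg _) hC0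
  have h6 : ‖R X V - X‖ ≤ (1 + M₂ * B) * ‖V‖ := by
    refine (hp.norm_retr_sub_le hX V).trans ?_
    have := mul_le_mul_of_nonneg_right hV (norm_nonneg V)
    nlinarith
  have h7 : (L : ℝ) * ‖R X V - X‖ ^ 2 ≤ L * ((1 + M₂ * B) * ‖V‖) ^ 2 := by gcongr
  rw [h3] at h1
  linarith

section Direction

variable {X : Mat n r} {H : tangent X →L[ℝ] tangent X} {V : tangent X}

/-- The line-search condition holds for all small stepsizes. -/
theorem armijo_of_le (hp : IsProblem f h R L Lh M₂) (P : Params) (hX : X ∈ Stiefel n r)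
    (hmin : ∀ W, model f h R X H V ≤ model f h R X H W)
    (hq : 3 * Lh * M₂ * ‖V‖ ^ 2 ≤ inner ℝ (H V) V) {C α : ℝ} (hα0 : 0 ≤ α) (hα1 : α ≤ 1)
    (hup : f (R X (α • V : tangent X)) ≤
      f X + inner ℝ (rgrad f X) ((α • V : tangent X) : Mat n r) + C * ‖α • V‖ ^ 2)
    (hα : C * α ≤ 5 / 8 * (Lh * M₂)) : Armijo P f h R X H V α := by
  have hLM := hp.mul_pos
  have h1 := comp_retr_weakly_convex hp.retr_lipschitz hX hp.convex hp.lipschitz 0 V hα0 hα1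
  have h2 := model_minimizer_growth hp.retr_lipschitz hX hp.convex hp.lipschitz hmin 0
  rw [model_zero hp.retr hX, model] at h2
  simp only [zero_sub, map_neg, inner_neg_left, inner_neg_right, neg_neg, norm_neg] at h2
  simp only [sub_zero, zero_add, ZeroMemClass.coe_zero, hp.retr.map_zero X hX] at h1
  have hc : ((α • V : tangent X) : Mat n r) = α • (V : Mat n r) := rfl
  rw [norm_smul, Real.norm_of_nonneg hα0, hc, real_inner_smul_right] at hup
  rw [hc] at h1
  rw [Armijo, hc]
  set a := inner ℝ (H V) V
  set g := inner ℝ (rgrad f X) (V : Mat n r)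
  have ha : 0 ≤ a := le_trans (by have := hLM.le; nlinarith [sq_nonneg ‖V‖]) hq
  -- Per unit of `α` the change of `F` is at most `-a + (1 + 1 + 5/8) L_h M₂ ‖V‖²`, where `a = ⟨H V,
  -- V⟩ ≥ 3 L_h M₂ ‖V‖²`. As `21/8 = 3 · 7/8`, this is at most `-a/8`, which suffices because `σ <
  -- 1/4`.
  have e1 : α * (g + h (R X V) - h X) ≤ α * (-a + Lh * M₂ * ‖V‖ ^ 2) :=
    mul_le_mul_of_nonneg_left (by linarith) hα0
  have e2 : C * (α * ‖V‖) ^ 2 ≤ α * (5 / 8 * (Lh * M₂) * ‖V‖ ^ 2) := by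
    have := mul_le_mul_of_nonneg_right hα (mul_nonneg hα0 (sq_nonneg ‖V‖))
    linarith
  have e3 : Lh * M₂ * (α * (1 - α)) * ‖V‖ ^ 2 ≤ α * (Lh * M₂ * ‖V‖ ^ 2) := by
    have : 0 ≤ Lh * M₂ * ‖V‖ ^ 2 * α ^ 2 := by positivity
    linarith
  have e4 : α * (21 / 8 * (Lh * M₂) * ‖V‖ ^ 2) ≤ α * (7 / 8 * a) :=
    mul_le_mul_of_nonneg_left (by linarith) hα0
  have e5 : P.σ * (α * a) ≤ 1 / 4 * (α * a) :=
    mul_le_mul_of_nonneg_right P.σ_lt.le (mul_nonneg hα0 ha)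
  linarith

/-- The denominator of the ratio is strictly negative, so clearing it reverses inequalities. -/
theorem model_smul_lt (hp : IsProblem f h R L Lh M₂) (hX : X ∈ Stiefel n r)
    (hmin : ∀ W, model f h R X H V ≤ model f h R X H W) (hV : V ≠ 0)
    (hq : 3 * Lh * M₂ * ‖V‖ ^ 2 ≤ inner ℝ (H V) V) {α : ℝ} (hα0 : 0 < α) (hα1 : α ≤ 1) :
    model f h R X H (α • V) - model f h R X H 0 < 0 := by
  have hpos : 0 < Lh * M₂ * ‖V‖ ^ 2 :=
    _root_.mul_pos hp.mul_pos (pow_pos (norm_pos_iff.2 hV) 2)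
  refine (model_smul_sub_le hp.retr_lipschitz hX hp.convex hp.lipschitz hmin hα0.le hα1
    (by linarith)).trans_lt ?_
  rw [neg_lt_zero]
  exact _root_.mul_pos hα0 (by linarith)

/-- The actual-to-predicted ratio is at least one when the model overestimates the objective. -/
theorem one_le_ratio (hp : IsProblem f h R L Lh M₂) (hX : X ∈ Stiefel n r)
    (hmin : ∀ W, model f h R X H V ≤ model f h R X H W) (hV : V ≠ 0)
    (hq : 3 * Lh * M₂ * ‖V‖ ^ 2 ≤ inner ℝ (H V) V) {C α : ℝ} (hα0 : 0 < α) (hα1 : α ≤ 1)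
    (hup : f (R X (α • V : tangent X)) ≤
      f X + inner ℝ (rgrad f X) ((α • V : tangent X) : Mat n r) + C * ‖α • V‖ ^ 2)
    (hC : 2 * C * ‖V‖ ^ 2 ≤ inner ℝ (H V) V) : 1 ≤ ratio f h R X H V α := by
  have hlt := hp.model_smul_lt hX hmin hV hq hα0 hα1
  rw [ratio, one_le_div_of_neg hlt, model_zero hp.retr hX, model, inner_map_smul_smul]
  rw [norm_smul, Real.norm_of_nonneg hα0.le] at hup
  have := mul_le_mul_of_nonneg_left hC (sq_nonneg α)
  nlinarith

/-- Directions for different regularization parameters are comparable. -/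
theorem norm_minimizer_le (hp : IsProblem f h R L Lh M₂) (hX : X ∈ Stiefel n r) {s s' : ℝ}
    {V' : tangent X} (hs : s ≤ s')
    (hmin : ∀ W, model f h R X (regularize H s) V ≤ model f h R X (regularize H s) W)
    (hmin' : ∀ W, model f h R X (regularize H s') V' ≤ model f h R X (regularize H s') W)
    (hq : ∀ W, 3 * Lh * M₂ * ‖W‖ ^ 2 ≤ inner ℝ (regularize H s W) W) :
    Lh * M₂ * ‖V‖ ≤ (Lh * M₂ + (s' - s)) * ‖V'‖ := by
  have hLM := hp.mul_pos
  -- Adding the growth inequalities of the two models, each tested at the other minimizer, leaves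
  -- only the difference of the regularization terms. If `‖V‖ > ‖V'‖`, the factor `‖V‖ - ‖V'‖` can
  -- then be divided out.
  have g1 := model_minimizer_growth hp.retr_lipschitz hX hp.convex hp.lipschitz hmin V'
  have g2 := model_minimizer_growth hp.retr_lipschitz hX hp.convex hp.lipschitz hmin' V
  rw [norm_sub_rev V V'] at g2
  have e1 : inner ℝ (regularize H s' (V - V')) (V - V') =
      inner ℝ (regularize H s (V' - V)) (V' - V) + (s' - s) * ‖V' - V‖ ^ 2 := by
    rw [inner_regularize, inner_regularize, ← neg_sub V' V, map_neg, inner_neg_neg, norm_neg]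
    ring
  have e2 : ∀ W, model f h R X (regularize H s') W =
      model f h R X (regularize H s) W + 1 / 2 * ((s' - s) * ‖W‖ ^ 2) := fun W => by
    simp only [model, inner_regularize]
    ring
  rw [e1, e2, e2] at g2
  have hqd := hq (V' - V)
  have key : (2 * (Lh * M₂) + (s' - s)) * ‖V' - V‖ ^ 2 ≤ (s' - s) * (‖V‖ ^ 2 - ‖V'‖ ^ 2) := by
    linarith
  rcases le_or_gt ‖V‖ ‖V'‖ with hle | hgt
  · have h1 : 0 ≤ (s' - s) * ‖V'‖ := mul_nonneg (sub_nonneg.2 hs) (norm_nonneg _)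
    nlinarith
  · have h1 : ‖V‖ - ‖V'‖ ≤ ‖V' - V‖ := by
      rw [norm_sub_rev]
      exact norm_sub_norm_le V V'
    have h2 : (‖V‖ - ‖V'‖) ^ 2 ≤ ‖V' - V‖ ^ 2 := pow_le_pow_left₀ (by linarith) h1 2
    have h3 : (‖V‖ - ‖V'‖) * ((2 * (Lh * M₂) + (s' - s)) * (‖V‖ - ‖V'‖)) ≤
        (‖V‖ - ‖V'‖) * ((s' - s) * (‖V‖ + ‖V'‖)) := by
      have := mul_le_mul_of_nonneg_left h2 (by linarith : 0 ≤ 2 * (Lh * M₂) + (s' - s))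
      linarith
    have h4 := le_of_mul_le_mul_left h3 (by linarith)
    linarith

end Direction

section Local

variable {Xs : Mat n r}

/-- The gap between `δ` and `5 L_h M₂` is spent on moving from `Xs` to nearby points. -/
theorem exists_le_inner_rHess (hp : IsProblem f h R L Lh M₂) (hXs : Xs ∈ Stiefel n r) {δ : ℝ}
    (hδ : 5 * (Lh : ℝ) * M₂ < δ) (hHess : δ ≤ lambdaMin (pullbackHess f R Xs)) :
    ∃ τ > 0, ∀ X : Mat n r, ‖X - Xs‖ < τ →
      ∀ W : tangent X, 5 * Lh * M₂ * ‖W‖ ^ 2 ≤ inner ℝ (rHess f X W) W := by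
  have h1 := eventually_le_inner_rHess (f := f) hp.contDiff hδ fun ξ => by
    rw [← inner_pullbackHess hp.contDiff hp.retr hp.second_order hXs]
    exact (mul_le_mul_of_nonneg_right hHess (sq_nonneg _)).trans (lambdaMin_mul_le _ ξ)
  obtain ⟨τ, hτ, hb⟩ := Metric.eventually_nhds_iff.1 h1
  exact ⟨τ, hτ, fun X hX => hb (by rwa [dist_eq_norm])⟩

/-- Near `Xs`, small directions are accepted with unit stepsize, very successfully. -/
theorem exists_unit_step (hp : IsProblem f h R L Lh M₂) (P : Params) (hXs : Xs ∈ Stiefel n r)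
    {δ : ℝ} (hδ : 5 * (Lh : ℝ) * M₂ < δ) (hHess : δ ≤ lambdaMin (pullbackHess f R Xs)) :
    ∃ τ > 0, ∀ X ∈ Stiefel n r, ‖X - Xs‖ < τ → ∀ s : ℝ, 0 ≤ s → ∀ V : tangent X, V ≠ 0 → ‖V‖ < τ →
      (∀ W, model f h R X (regularize (rHess f X) s) V ≤
        model f h R X (regularize (rHess f X) s) W) →
      Armijo P f h R X (regularize (rHess f X) s) V 1 ∧
      P.η₂ ≤ ratio f h R X (regularize (rHess f X) s) V 1 := by
  have hLM := hp.mul_pos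
  have hη : 0 < 1 - P.η₂ := sub_pos.2 P.η₂_lt
  have hη0 : 0 < P.η₂ := P.η₁_pos.trans P.η₁_lt
  obtain ⟨τ₁, hτ₁, H₁⟩ := hp.exists_le_inner_rHess hXs hδ hHess
  -- The model decreases by at least `(3/2) L_h M₂ ‖V‖²`, so this Taylor error is below `1 - η₂`
  -- times the decrease. The Armijo test needs `(3/8) ⟨ℍ V, V⟩` to dominate `(3/2) L_h M₂ ‖V‖²`,
  -- which the factor `5` covers.
  obtain ⟨τ₂, hτ₂, H₂⟩ := exists_taylor_two_retr hp.contDiff hp.retr hp.second_order hXs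
    (ε := (1 - P.η₂) / 2 * (Lh * M₂)) (by positivity)
  refine ⟨min τ₁ τ₂, lt_min hτ₁ hτ₂, fun X hX hd s hs V hV0 hV hmin => ?_⟩
  have hH := H₁ X (hd.trans_le (min_le_left _ _)) V
  have hT := (abs_le.1 (H₂ X hX (hd.trans_le (min_le_right _ _)) V
    (hV.trans_le (min_le_right _ _)))).2
  have hVp : 0 < Lh * M₂ * ‖V‖ ^ 2 := _root_.mul_pos hLM (pow_pos (norm_pos_iff.2 hV0) 2)
  have hsV : 0 ≤ s * ‖V‖ ^ 2 := mul_nonneg hs (sq_nonneg _)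
  have hreg := inner_regularize (rHess f X) s V
  have hdec := model_smul_sub_le hp.retr_lipschitz hX hp.convex hp.lipschitz hmin zero_le_one le_rfl
    (by linarith)
  have hlt := hp.model_smul_lt hX hmin hV0 (by linarith) zero_lt_one le_rfl
  rw [Armijo, ratio, le_div_iff_of_neg hlt]
  rw [one_smul, model_zero hp.retr hX] at *
  set D := model f h R X (regularize (rHess f X) s) V - h X with hD
  have hnum : f (R X V) + h (R X V) - (f X + h X) ≤ D + (1 - P.η₂) / 2 * (Lh * M₂) * ‖V‖ ^ 2 := by
    rw [hD, model, hreg]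
    linarith
  have hηV : P.η₂ * (Lh * M₂ * ‖V‖ ^ 2) ≤ 1 * (Lh * M₂ * ‖V‖ ^ 2) :=
    mul_le_mul_of_nonneg_right P.η₂_lt.le hVp.le
  have hηV' : 0 ≤ P.η₂ * (Lh * M₂ * ‖V‖ ^ 2) := by positivity
  constructor
  · have hσ : P.σ * inner ℝ (regularize (rHess f X) s V) V ≤
        1 / 4 * inner ℝ (regularize (rHess f X) s V) V :=
      mul_le_mul_of_nonneg_right P.σ_lt.le (by linarith)
    linarith
  · have hD' : D ≤ -(3 / 2 * (Lh * M₂ * ‖V‖ ^ 2)) := by linarith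
    have := mul_le_mul_of_nonneg_left hD' hη.le
    nlinarith

end Local

end IsProblem

/-- Elementary bookkeeping behind the local estimate: `a`, `b`, `d` are the norms of the direction,
of the exact step and of their difference; `e`, `e'` are the old and the new error. -/
theorem contraction_arith {c S ε : ℝ} (hc : 0 < c) (hS : 0 ≤ S) (hε : 0 < ε) :
    ∃ κ ε₀ : ℝ, 0 < κ ∧ 0 < ε₀ ∧ ∀ s a b d e e' : ℝ, 0 ≤ s → s ≤ S → 0 ≤ a → 0 ≤ b → 0 ≤ d →
      0 ≤ e → 0 ≤ e' → a ≤ d + b → e' ≤ (1 + κ) * d → (1 - κ) * b ≤ e →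
      (c + s) * d ^ 2 ≤ 2 * ε₀ * (a ^ 2 + b ^ 2) + s * (b ^ 2 - a ^ 2) →
      (c + s) * e' ^ 2 ≤ (s + ε) * e ^ 2 := by
  -- A crude bound `d² ≤ K b²` comes first; it makes all Taylor errors at most `(ε/6) b²`. The
  -- coefficient of `s` must stay `1` up to a small relative error, which is why `κ` depends on `S`:
  -- a fixed larger factor would destroy the contraction for large `s`.
  set K := 2 * (c + S) / c with hK
  have hK0 : 0 ≤ K := by positivity
  have hcK : c * K = 2 * (c + S) := by rw [hK]; field_simp
  set ε₀ := min (c / 8) (ε / (6 * (6 + 4 * K))) with hε₀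
  set κ := min (1 / 4) (ε / (16 * (S + 1))) with hκ
  have hε₀0 : 0 < ε₀ := lt_min (by positivity) (by positivity)
  have hκ0 : 0 < κ := lt_min (by norm_num) (by positivity)
  have h1 : ε₀ ≤ c / 8 := min_le_left _ _
  have h2 : (6 + 4 * K) * ε₀ ≤ ε / 6 := by
    have := (le_div_iff₀ (by positivity : 0 < 6 * (6 + 4 * K))).1
      (min_le_right (c / 8) (ε / (6 * (6 + 4 * K))))
    rw [← hε₀] at this
    linarith
  have h3 : κ ≤ 1 / 4 := min_le_left _ _
  have h4 : 16 * κ * S ≤ ε := by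
    have := (le_div_iff₀ (by positivity : 0 < 16 * (S + 1))).1
      (min_le_right (1 / 4) (ε / (16 * (S + 1))))
    rw [← hκ] at this
    linarith
  refine ⟨κ, ε₀, hκ0, hε₀0, fun s a b d e e' hs hsS ha hb hd he he' hab hed hbe hmain => ?_⟩
  have ha2 : a ^ 2 ≤ 2 * d ^ 2 + 2 * b ^ 2 := by nlinarith [sq_nonneg (d - b)]
  have hsa : 0 ≤ s * a ^ 2 := by positivity
  have hm1 : (c + s) * d ^ 2 ≤ 4 * ε₀ * d ^ 2 + (6 * ε₀ + s) * b ^ 2 := by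
    have := mul_le_mul_of_nonneg_left ha2 hε₀0.le
    linarith
  have hdK : d ^ 2 ≤ K * b ^ 2 := by
    have e1 : 4 * ε₀ * d ^ 2 ≤ c / 2 * d ^ 2 := by gcongr; linarith
    have e2 : (6 * ε₀ + s) * b ^ 2 ≤ (c + S) * b ^ 2 := by gcongr; linarith
    have e3 : 0 ≤ s * d ^ 2 := by positivity
    have e4 : c * d ^ 2 ≤ c * (K * b ^ 2) := by
      rw [← mul_assoc, hcK]
      linarith
    exact le_of_mul_le_mul_left e4 hc
  have hm2 : (c + s) * d ^ 2 ≤ (s + ε / 6) * b ^ 2 := by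
    have e1 := mul_le_mul_of_nonneg_left hdK (by positivity : 0 ≤ 4 * ε₀)
    have e2 := mul_le_mul_of_nonneg_right h2 (sq_nonneg b)
    linarith
  have he'2 : e' ^ 2 ≤ (1 + κ) ^ 2 * d ^ 2 := by
    rw [← mul_pow]
    exact pow_le_pow_left₀ he' hed 2
  have hb2 : (1 - κ) ^ 2 * b ^ 2 ≤ e ^ 2 := by
    rw [← mul_pow]
    exact pow_le_pow_left₀ (mul_nonneg (by linarith) hb) hbe 2
  have hκ2 : (1 + κ) ^ 2 ≤ (1 + 8 * κ) * (1 - κ) ^ 2 := by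
    have : 0 ≤ κ * (4 - 16 * κ + 8 * κ ^ 2) := mul_nonneg hκ0.le (by nlinarith [sq_nonneg κ])
    linarith
  calc (c + s) * e' ^ 2 ≤ (c + s) * ((1 + κ) ^ 2 * d ^ 2) := by gcongr
    _ = (1 + κ) ^ 2 * ((c + s) * d ^ 2) := by ring
    _ ≤ (1 + κ) ^ 2 * ((s + ε / 6) * b ^ 2) := by gcongr
    _ ≤ ((1 + 8 * κ) * (1 - κ) ^ 2) * ((s + ε / 6) * b ^ 2) := by gcongr
    _ = ((1 + 8 * κ) * (s + ε / 6)) * ((1 - κ) ^ 2 * b ^ 2) := by ring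
    _ ≤ ((1 + 8 * κ) * (s + ε / 6)) * e ^ 2 := by gcongr
    _ ≤ (s + ε) * e ^ 2 := by
      have e1 : κ * s ≤ κ * S := by gcongr
      have e2 : κ * ε ≤ 1 / 4 * ε := by gcongr
      have e3 : (1 + 8 * κ) * (s + ε / 6) ≤ s + ε := by linarith
      exact mul_le_mul_of_nonneg_right e3 (sq_nonneg e)

/-! ### The one-step error estimate. -/

namespace IsProblem

variable {f h : Mat n r → ℝ} {R : Mat n r → Mat n r → Mat n r} {L Lh : ℝ≥0} {M₂ : ℝ}
  {Xs : Mat n r}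

/-- The error after a unit step is controlled by the regularization parameter. -/
theorem exists_error_le (hp : IsProblem f h R L Lh M₂) (hXs : Xs ∈ Stiefel n r)
    {δ : ℝ} (hδ : 5 * (Lh : ℝ) * M₂ < δ) (hHess : δ ≤ lambdaMin (pullbackHess f R Xs))
    {S ε : ℝ} (hS : 0 ≤ S) (hε : 0 < ε) :
    ∃ τ > 0, ∀ X ∈ Stiefel n r, ‖X - Xs‖ < τ → ∀ s : ℝ, 0 ≤ s → s ≤ S → ∀ V : tangent X, ‖V‖ < τ →
      (∀ W, model f h R X (regularize (rHess f X) s) V ≤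
        model f h R X (regularize (rHess f X) s) W) →
      f Xs + h Xs ≤ f (R X V) + h (R X V) →
      (3 * Lh * M₂ + s) * ‖R X V - Xs‖ ^ 2 ≤ (s + ε) * ‖X - Xs‖ ^ 2 := by
  have hLM := hp.mul_pos
  have hM := hp.M₂_pos
  obtain ⟨κ, ε₀, hκ, hε₀, harith⟩ :=
    contraction_arith (c := 3 * Lh * M₂) (by linarith) hS hε
  obtain ⟨τ₁, hτ₁, H₁⟩ := hp.exists_le_inner_rHess hXs hδ hHess
  obtain ⟨τ₂, hτ₂, H₂⟩ := exists_taylor_two_retr hp.contDiff hp.retr hp.second_order hXs hε₀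
  obtain ⟨τ₃, hτ₃, H₃⟩ := exists_retr_eq hp.retr hp.retr_lipschitz hM hXs
  -- The halved radii absorb `‖ξ‖ ≤ 2 ‖X - Xs‖`; within `κ / (2 M₂)` the map `R X` distorts
  -- differences by a relative error of at most `κ`.
  refine ⟨min (min τ₁ (τ₂ / 2)) (min τ₃ (κ / (4 * M₂))), by positivity,
    fun X hX hd s hs hsS V hV hmin hdec => ?_⟩
  simp only [lt_min_iff] at hd hV
  obtain ⟨⟨hd1, hd2⟩, hd3, hd4⟩ := hd
  obtain ⟨⟨-, hV2⟩, -, hV4⟩ := hV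
  obtain ⟨ξ, hξ, hξn⟩ := H₃ X hX hd3
  have hH := H₁ X hd1 (ξ - V)
  have hTV := (abs_le.1 (H₂ X hX (by linarith) V (by linarith))).2
  have hTξ := (abs_le.1 (H₂ X hX (by linarith) ξ (by linarith))).1
  have hgrow := model_minimizer_growth hp.retr_lipschitz hX hp.convex hp.lipschitz hmin ξ
  rw [inner_regularize, model, model, inner_regularize, inner_regularize] at hgrow
  rw [hξ] at hTξ hgrow
  have hκM : 2 * M₂ * (κ / (2 * M₂)) = κ := by field_simp
  have hhalf : κ / (4 * M₂) = κ / (2 * M₂) / 2 := by field_simp; norm_num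
  have hVρ : ‖V‖ ≤ κ / (2 * M₂) := by linarith [norm_nonneg V]
  have hξρ : ‖ξ‖ ≤ κ / (2 * M₂) := by linarith
  have hiso := hp.retr_lipschitz.norm_retr_sub_retr_le hp.retr hM.le hX hVρ hξρ
  have hiso0 := hp.retr_lipschitz.norm_retr_sub_retr_le hp.retr hM.le hX hξρ
    (W := 0) (by simpa using (norm_nonneg _).trans hξρ)
  rw [hκM, hξ] at hiso hiso0
  rw [Submodule.coe_zero, hp.retr.map_zero X hX, sub_zero, sub_zero] at hiso0
  refine harith s ‖V‖ ‖ξ‖ ‖ξ - V‖ ‖X - Xs‖ ‖R X V - Xs‖ hs hsS (norm_nonneg _) (norm_nonneg _)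
    (norm_nonneg _) (norm_nonneg _) (norm_nonneg _) ?_ ?_ ?_ ?_
  · rw [norm_sub_rev]
    linarith [norm_le_norm_sub_add V ξ]
  · have h1 := norm_le_norm_sub_add (R X V - Xs) ((V : Mat n r) - ξ)
    have h2 : ‖(V : Mat n r) - ξ‖ = ‖V - ξ‖ := rfl
    rw [norm_sub_rev ξ V]
    linarith
  · have h1 := norm_le_norm_sub_add (ξ : Mat n r) (Xs - X)
    rw [norm_sub_rev (ξ : Mat n r), norm_sub_rev Xs X] at h1
    have h2 : ‖(ξ : Mat n r)‖ = ‖ξ‖ := rfl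
    linarith
  -- Growth at `ξ`, the two Taylor bounds and `F(Xs) ≤ F(R X V)` combine; `3 = 5 - 2` is the Hessian
  -- bound minus the weak convexity loss.
  · linarith

end IsProblem

/-! ### Global behaviour of a run and convergence. -/

namespace Run.IsGenerated

variable {f h : Mat n r → ℝ} {R : Mat n r → Mat n r → Mat n r} {L Lh : ℝ≥0} {M₂ : ℝ}
  {P : Params} {T : Run n r}

theorem step_pos (P : Params) (T : Run n r) (k j : ℕ) : 0 < T.step P k j := pow_pos P.γ_pos _

theorem step_le_one (P : Params) (T : Run n r) (k j : ℕ) : T.step P k j ≤ 1 :=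
  pow_le_one₀ P.γ_pos.le P.γ_lt.le

theorem mem_stiefel (hT : T.IsGenerated P f h R Lh M₂) (hR : IsRetraction R) (k : ℕ) :
    T.X k ∈ Stiefel n r := by
  induction k with
  | zero => exact hT.init_mem
  | succ k ih =>
    rw [hT.next_point k]
    exact hR.mem _ ih _ (Subtype.prop _)

theorem s_pos (hT : T.IsGenerated P f h R Lh M₂) (k : ℕ) : 0 < T.s k := by
  induction k with
  | zero => rw [hT.init_reg]; exact P.σ₀_pos
  | succ k ih =>
    have h0 : 0 < T.reg P k (T.J k) :=
      mul_pos (pow_pos (zero_lt_one.trans P.γ₂_gt) _) ih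
    rcases le_or_gt P.η₂ (T.rho P f h R k (T.J k)) with hle | hlt
    · rw [(hT.next_reg k).1 hle]
      exact mul_pos P.γ₁_pos h0
    · rw [(hT.next_reg k).2 hlt]
      exact h0

theorem reg_pos (hT : T.IsGenerated P f h R Lh M₂) (k j : ℕ) : 0 < T.reg P k j :=
  mul_pos (pow_pos (zero_lt_one.trans P.γ₂_gt) _) (hT.s_pos k)

theorem reg_mono (hT : T.IsGenerated P f h R Lh M₂) (k : ℕ) : Monotone (T.reg P k) := by
  intro i j hij
  exact mul_le_mul_of_nonneg_right
    (pow_le_pow_right₀ P.γ₂_gt.le (Nat.add_le_add_left hij _)) (hT.s_pos k).le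

theorem reg_succ (P : Params) (T : Run n r) (k j : ℕ) :
    T.reg P k (j + 1) = P.γ₂ * T.reg P k j := by
  rw [reg, reg, ← add_assoc, pow_succ]
  ring

theorem next_le_reg (hT : T.IsGenerated P f h R Lh M₂) (k : ℕ) :
    T.s (k + 1) ≤ T.reg P k (T.J k) := by
  rcases le_or_gt P.η₂ (T.rho P f h R k (T.J k)) with hle | hlt
  · rw [(hT.next_reg k).1 hle]
    exact mul_le_of_le_one_left (hT.reg_pos k _).le P.γ₁_lt.le
  · exact ((hT.next_reg k).2 hlt).le

/-- The operators of all passes are uniformly positive definite. -/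
theorem le_inner_op (hT : T.IsGenerated P f h R Lh M₂) (k j : ℕ) (W : tangent (T.X k)) :
    (3 * Lh * M₂ + 1 / 2 * T.reg P k j) * ‖W‖ ^ 2 ≤ inner ℝ (T.op P k j W) W := by
  have h1 : 3 * Lh * M₂ < lambdaMin (T.H k) + 1 / 2 * T.reg P k 0 := (hT.first_loop k).1
  have h2 := hT.reg_mono k (Nat.zero_le j)
  have h3 := lambdaMin_mul_le (T.H k) W
  rw [op, inner_regularize]
  nlinarith [sq_nonneg ‖W‖]

theorem three_mul_le_inner_op (hT : T.IsGenerated P f h R Lh M₂) (k j : ℕ)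
    (W : tangent (T.X k)) : 3 * Lh * M₂ * ‖W‖ ^ 2 ≤ inner ℝ (T.op P k j W) W := by
  have h1 := hT.le_inner_op k j W
  have h2 : 0 ≤ T.reg P k j * ‖W‖ ^ 2 := mul_nonneg (hT.reg_pos k j).le (sq_nonneg _)
  linarith

theorem exists_norm_le (hT : T.IsGenerated P f h R Lh M₂) (hp : IsProblem f h R L Lh M₂) :
    ∃ B : ℝ, 0 ≤ B ∧ ∀ k, ∀ j ≤ T.J k, ‖T.V k j‖ ≤ B := by
  obtain ⟨B, hB, h1⟩ := hp.exists_direction_bound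
  exact ⟨B, hB, fun k j hj => h1 _ (hT.mem_stiefel hp.retr k) _ _ (hT.direction k j hj)
    (hT.three_mul_le_inner_op k j _)⟩

theorem exists_upper_bound (hT : T.IsGenerated P f h R Lh M₂) (hp : IsProblem f h R L Lh M₂) :
    ∃ C : ℝ, 0 ≤ C ∧ ∀ k, ∀ j ≤ T.J k, ∀ α : ℝ, 0 ≤ α → α ≤ 1 →
      f (R (T.X k) (α • T.V k j : tangent (T.X k))) ≤ f (T.X k) +
        inner ℝ (rgrad f (T.X k)) ((α • T.V k j : tangent (T.X k)) : Mat n r) +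
        C * ‖α • T.V k j‖ ^ 2 := by
  obtain ⟨B, hB, h1⟩ := hT.exists_norm_le hp
  obtain ⟨C, hC, h2⟩ := hp.exists_upper_bound hB
  refine ⟨C, hC, fun k j hj α hα0 hα1 => h2 _ (hT.mem_stiefel hp.retr k) _ ?_⟩
  rw [norm_smul, Real.norm_of_nonneg hα0]
  exact (mul_le_of_le_one_left (norm_nonneg _) hα1).trans (h1 k j hj)

/-- The stepsizes are bounded away from zero. -/
theorem exists_le_step (hT : T.IsGenerated P f h R Lh M₂) (hp : IsProblem f h R L Lh M₂) :
    ∃ α : ℝ, 0 < α ∧ ∀ k, ∀ j ≤ T.J k, α ≤ T.step P k j := by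
  obtain ⟨C, hC, hup⟩ := hT.exists_upper_bound hp
  have hLM := hp.mul_pos
  obtain ⟨m, hm⟩ := exists_pow_lt_of_lt_one
    (by positivity : 0 < 5 / 8 * (Lh * M₂) / (C + 1)) P.γ_lt
  rw [lt_div_iff₀ (by positivity)] at hm
  have hγm : 0 < P.γ ^ m := pow_pos P.γ_pos m
  have hγ1 : P.γ ^ m ≤ 1 := pow_le_one₀ P.γ_pos.le P.γ_lt.le
  refine ⟨P.γ ^ m, hγm, fun k j hj => pow_le_pow_of_le_one P.γ_pos.le P.γ_lt.le
    ((hT.line_search k j hj).2 ?_)⟩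
  exact hp.armijo_of_le P (hT.mem_stiefel hp.retr k) (hT.direction k j hj)
    (hT.three_mul_le_inner_op k j _) hγm.le hγ1 (hup k j hj _ hγm.le hγ1) (by linarith)

/-- The regularization parameters stay bounded. -/
theorem exists_reg_le (hT : T.IsGenerated P f h R Lh M₂) (hp : IsProblem f h R L Lh M₂)
    (hH : ∀ k, T.H k = rHess f (T.X k)) (hV : ∀ k, ∀ j ≤ T.J k, T.V k j ≠ 0) :
    ∃ S : ℝ, 0 ≤ S ∧ ∀ k, ∀ j ≤ T.J k, T.reg P k j ≤ S := by
  obtain ⟨C, hC, hup⟩ := hT.exists_upper_bound hp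
  obtain ⟨D, hD, hb⟩ := hp.exists_bound
  have hLM := hp.mul_pos
  have hγ₂ : 0 < P.γ₂ := zero_lt_one.trans P.γ₂_gt
  -- Besides `σ₀`, the entries are `γ₂` times the largest parameters that can still be raised: in
  -- the first loop `-D + σ/2 ≤ 3 L_h M₂`, and at a rejection `σ ≤ 2C + D`, since beyond that the
  -- ratio is at least `1`.
  set S := max P.σ₀ (P.γ₂ * max (2 * (3 * Lh * M₂ + D)) (2 * C + D)) with hS
  have hreg0 : ∀ k, T.s k ≤ S → T.reg P k 0 ≤ S := by
    intro k hk
    rcases Nat.eq_zero_or_eq_succ_pred (T.p k) with h0 | h0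
    · simpa [reg, h0] using hk
    · set q := (T.p k).pred
      have hq : q ∉ {q : ℕ | 3 * Lh * M₂ < lambdaMin (T.H k) + (1 / 2) * (P.γ₂ ^ q * T.s k)} :=
        fun hmem => by
          have := (hT.first_loop k).2 hmem
          omega
      rw [mem_ofPred_eq, not_lt] at hq
      have hlam : -D ≤ lambdaMin (T.H k) := le_lambdaMin (hV k 0 (Nat.zero_le _)) fun W => by
        rw [hH]
        exact (hb _ (hT.mem_stiefel hp.retr k)).2 W
      have h1 : T.reg P k 0 = P.γ₂ * (P.γ₂ ^ q * T.s k) := by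
        rw [reg, add_zero, h0, pow_succ]
        ring
      rw [h1]
      refine le_trans (mul_le_mul_of_nonneg_left ?_ hγ₂.le) (le_max_right _ _)
      exact le_trans (by linarith) (le_max_left _ _)
  have hregJ : ∀ k, T.s k ≤ S → T.reg P k (T.J k) ≤ S := by
    intro k hk
    rcases Nat.eq_zero_or_eq_succ_pred (T.J k) with h0 | h0
    · rw [h0]
      exact hreg0 k hk
    · set i := (T.J k).pred
      have hi : i < T.J k := by omega
      have hrej := hT.rejected k i hi
      rw [h0, reg_succ]
      refine le_trans (mul_le_mul_of_nonneg_left ?_ hγ₂.le) (le_max_right _ _)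
      refine le_trans ?_ (le_max_right _ _)
      by_contra! hlt
      have h1 := hp.one_le_ratio (hT.mem_stiefel hp.retr k) (hT.direction k i hi.le) (hV k i hi.le)
        (hT.three_mul_le_inner_op k i _) (step_pos P T k i) (step_le_one P T k i)
        (hup k i hi.le _ (step_pos P T k i).le (step_le_one P T k i)) ?_
      · have h2 := P.η₁_lt.trans P.η₂_lt
        rw [rho] at hrej
        linarith
      · have h3 := (hb _ (hT.mem_stiefel hp.retr k)).2 (T.V k i)
        rw [op, inner_regularize, hH]
        have h4 := mul_le_mul_of_nonneg_right hlt.le (sq_nonneg ‖T.V k i‖)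
        linarith
  have hs : ∀ k, T.s k ≤ S := by
    intro k
    induction k with
    | zero => rw [hT.init_reg]; exact le_max_left _ _
    | succ k ih => exact (hT.next_le_reg k).trans (hregJ k ih)
  exact ⟨S, P.σ₀_pos.le.trans (le_max_left _ _), fun k j hj =>
    (hT.reg_mono k hj).trans (hregJ k (hs k))⟩

/-- Sufficient decrease of the objective. -/
theorem exists_decrease (hT : T.IsGenerated P f h R Lh M₂) (hp : IsProblem f h R L Lh M₂) :
    ∃ c : ℝ, 0 < c ∧ ∀ k, f (T.X (k + 1)) + h (T.X (k + 1)) + c * ‖T.V k (T.J k)‖ ^ 2 ≤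
      f (T.X k) + h (T.X k) := by
  obtain ⟨α, hα, hstep⟩ := hT.exists_le_step hp
  have hLM := hp.mul_pos
  have hσ := P.σ_pos
  refine ⟨1 / 2 * P.σ * α * (3 * (Lh * M₂)), by positivity, fun k => ?_⟩
  have h1 : f (R (T.X k) (T.step P k (T.J k) • T.V k (T.J k) : tangent (T.X k))) +
      h (R (T.X k) (T.step P k (T.J k) • T.V k (T.J k) : tangent (T.X k))) ≤
      f (T.X k) + h (T.X k) - (1 / 2) * P.σ * T.step P k (T.J k) *
        inner ℝ (T.op P k (T.J k) (T.V k (T.J k))) (T.V k (T.J k)) :=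
    (hT.line_search k _ le_rfl).1
  rw [← hT.next_point k] at h1
  have h2 : 1 / 2 * P.σ * α * (3 * (Lh * M₂) * ‖T.V k (T.J k)‖ ^ 2) ≤
      (1 / 2) * P.σ * T.step P k (T.J k) *
        inner ℝ (T.op P k (T.J k) (T.V k (T.J k))) (T.V k (T.J k)) := by
    have h3 := hT.three_mul_le_inner_op k (T.J k) (T.V k (T.J k))
    have h4 := hstep k _ le_rfl
    have h5 := step_pos P T k (T.J k)
    refine mul_le_mul ?_ (by linarith) (by positivity) (by positivity)
    gcongr
  linarith

theorem antitone_objective (hT : T.IsGenerated P f h R Lh M₂) (hp : IsProblem f h R L Lh M₂) :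
    Antitone fun k => f (T.X k) + h (T.X k) := by
  obtain ⟨c, hc, hdec⟩ := hT.exists_decrease hp
  refine antitone_nat_of_succ_le fun k => ?_
  have : 0 ≤ c * ‖T.V k (T.J k)‖ ^ 2 := by positivity
  linarith [hdec k]

/-- Once `F` falls below `F(Xs)` it stays there by monotonicity, contradicting continuity at the
cluster point. This replaces any assumption that `Xs` is a local minimizer. -/
theorem objective_le (hT : T.IsGenerated P f h R Lh M₂) (hp : IsProblem f h R L Lh M₂)
    {Xs : Mat n r} (hXs : MapClusterPt Xs atTop T.X) (k : ℕ) :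
    f Xs + h Xs ≤ f (T.X k) + h (T.X k) := by
  by_contra! hlt
  have hc : ContinuousAt (fun X => f X + h X) Xs :=
    (hp.contDiff.continuous.add hp.lipschitz.continuous).continuousAt
  have h1 := hXs.frequently (hc.eventually_const_lt hlt)
  obtain ⟨j, hj, hkj⟩ := (h1.and_eventually (eventually_ge_atTop k)).exists
  exact absurd (hT.antitone_objective hp hkj) (not_le.2 hj)

/-- `F(X_k)` decreases and is bounded below by `F(Xs)`, so its successive differences tend to zero
and dominate `c ‖V_k‖²`. -/
theorem tendsto_direction (hT : T.IsGenerated P f h R Lh M₂) (hp : IsProblem f h R L Lh M₂)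
    {Xs : Mat n r} (hXs : MapClusterPt Xs atTop T.X) :
    Tendsto (fun k => ‖T.V k (T.J k)‖) atTop (𝓝 0) := by
  obtain ⟨c, hc, hdec⟩ := hT.exists_decrease hp
  have hlim := tendsto_atTop_ciInf (hT.antitone_objective hp)
    ⟨f Xs + h Xs, by rintro _ ⟨k, rfl⟩; exact hT.objective_le hp hXs k⟩
  have hdiff := (hlim.sub (hlim.comp (tendsto_add_atTop_nat 1))).div_const c
  rw [sub_self, zero_div] at hdiff
  have hsq : Tendsto (fun k => ‖T.V k (T.J k)‖ ^ 2) atTop (𝓝 0) :=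
    squeeze_zero (fun k => sq_nonneg _) (fun k => by
      rw [le_div_iff₀ hc]
      have := hdec k
      simp only [Function.comp_apply]
      linarith) hdiff
  have := hsq.sqrt
  simpa using this

/-- The directions of all passes, also the rejected ones, tend to zero. -/
theorem eventually_norm_lt (hT : T.IsGenerated P f h R Lh M₂) (hp : IsProblem f h R L Lh M₂)
    (hH : ∀ k, T.H k = rHess f (T.X k)) (hV : ∀ k, ∀ j ≤ T.J k, T.V k j ≠ 0)
    {Xs : Mat n r} (hXs : MapClusterPt Xs atTop T.X) {τ : ℝ} (hτ : 0 < τ) :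
    ∀ᶠ k in atTop, ∀ j ≤ T.J k, ‖T.V k j‖ < τ := by
  obtain ⟨S, hS, hreg⟩ := hT.exists_reg_le hp hH hV
  have hLM := hp.mul_pos
  have h1 := (hT.tendsto_direction hp hXs).const_mul (Lh * M₂ + S)
  rw [mul_zero] at h1
  filter_upwards [h1.eventually_lt_const (mul_pos hLM hτ)] with k hk j hj
  have h2 := hp.norm_minimizer_le (hT.mem_stiefel hp.retr k) (hT.reg_mono k hj)
    (hT.direction k j hj) (hT.direction k _ le_rfl) (hT.three_mul_le_inner_op k j)
  have h3 : (Lh * M₂ + (T.reg P k (T.J k) - T.reg P k j)) * ‖T.V k (T.J k)‖ ≤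
      (Lh * M₂ + S) * ‖T.V k (T.J k)‖ := by
    gcongr
    linarith [hreg k _ le_rfl, hT.reg_pos k j]
  exact lt_of_mul_lt_mul_left (h2.trans_lt (h3.trans_lt hk)) hLM.le

/-- Near `Xs`, once all directions are small, the first pass of the inner loop is accepted with
unit stepsize, and the regularization parameter decreases. -/
theorem exists_very_successful (hT : T.IsGenerated P f h R Lh M₂) (hp : IsProblem f h R L Lh M₂)
    (hH : ∀ k, T.H k = rHess f (T.X k)) (hV : ∀ k, ∀ j ≤ T.J k, T.V k j ≠ 0)
    {Xs : Mat n r} (hXs : Xs ∈ Stiefel n r) {δ : ℝ} (hδ : 5 * (Lh : ℝ) * M₂ < δ)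
    (hHess : δ ≤ lambdaMin (pullbackHess f R Xs)) :
    ∃ τ > 0, ∀ k, ‖T.X k - Xs‖ < τ → ‖T.V k 0‖ < τ →
      T.X (k + 1) = R (T.X k) (T.V k 0) ∧ T.J k = 0 ∧ T.reg P k 0 = T.s k ∧
        T.s (k + 1) = P.γ₁ * T.s k := by
  obtain ⟨τ₁, hτ₁, H₁⟩ := hp.exists_unit_step P hXs hδ hHess
  obtain ⟨τ₂, hτ₂, H₂⟩ := hp.exists_le_inner_rHess hXs hδ hHess
  refine ⟨min τ₁ τ₂, lt_min hτ₁ hτ₂, fun k hd hVk => ?_⟩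
  have hdir := hT.direction k 0 (Nat.zero_le _)
  have hop : T.op P k 0 = regularize (rHess f (T.X k)) (T.reg P k 0) := by rw [op, hH]
  rw [hop] at hdir
  obtain ⟨harm, hrat⟩ := H₁ _ (hT.mem_stiefel hp.retr k) (hd.trans_le (min_le_left _ _)) _
    (hT.reg_pos k 0).le _ (hV k 0 (Nat.zero_le _)) (hVk.trans_le (min_le_left _ _)) hdir
  have hN : T.N k 0 = 0 := Nat.le_zero.1 <| (hT.line_search k 0 (Nat.zero_le _)).2 <| by
    rw [mem_ofPred_eq, pow_zero, hop]
    exact harm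
  have hstep : T.step P k 0 = 1 := by rw [step, hN, pow_zero]
  have hrho : P.η₂ ≤ T.rho P f h R k 0 := by
    rw [rho, hstep, hop]
    exact hrat
  have hJ : T.J k = 0 := by
    by_contra hne
    have := hT.rejected k 0 (Nat.pos_of_ne_zero hne)
    linarith [P.η₁_lt]
  have hlam : 5 * Lh * M₂ ≤ lambdaMin (T.H k) := le_lambdaMin (hV k 0 (Nat.zero_le _)) fun W => by
    rw [hH]
    exact H₂ _ (hd.trans_le (min_le_right _ _)) W
  have hp0 : T.p k = 0 := Nat.le_zero.1 <| (hT.first_loop k).2 <| by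
    rw [mem_ofPred_eq, pow_zero, one_mul]
    linarith [hp.mul_pos, hT.s_pos k]
  have hreg : T.reg P k 0 = T.s k := by rw [reg, hp0, add_zero, pow_zero, one_mul]
  refine ⟨?_, hJ, hreg, ?_⟩
  · have := hT.next_point k
    rwa [hJ, hstep, one_smul] at this
  · have := (hT.next_reg k).1 (by rw [hJ]; exact hrho)
    rwa [hJ, hreg] at this

/-- The error estimate of a step near the limit, for the run of the algorithm. -/
theorem exists_error_le (hT : T.IsGenerated P f h R Lh M₂) (hp : IsProblem f h R L Lh M₂)
    (hH : ∀ k, T.H k = rHess f (T.X k)) (hV : ∀ k, ∀ j ≤ T.J k, T.V k j ≠ 0)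
    {Xs : Mat n r} (hXs : Xs ∈ Stiefel n r) (hcl : MapClusterPt Xs atTop T.X) {δ : ℝ}
    (hδ : 5 * (Lh : ℝ) * M₂ < δ) (hHess : δ ≤ lambdaMin (pullbackHess f R Xs)) {ε : ℝ}
    (hε : 0 < ε) :
    ∃ τ > 0, ∀ᶠ k in atTop, ‖T.X k - Xs‖ < τ → T.s (k + 1) = P.γ₁ * T.s k ∧
      (3 * Lh * M₂ + T.s k) * ‖T.X (k + 1) - Xs‖ ^ 2 ≤ (T.s k + ε) * ‖T.X k - Xs‖ ^ 2 := by
  obtain ⟨S, hS, hreg⟩ := hT.exists_reg_le hp hH hV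
  obtain ⟨τ₁, hτ₁, H₁⟩ := hT.exists_very_successful hp hH hV hXs hδ hHess
  obtain ⟨τ₂, hτ₂, H₂⟩ := hp.exists_error_le hXs hδ hHess hS hε
  refine ⟨min τ₁ τ₂, lt_min hτ₁ hτ₂, ?_⟩
  filter_upwards [hT.eventually_norm_lt hp hH hV hcl (lt_min hτ₁ hτ₂)] with k hk hd
  have hVk := hk 0 (Nat.zero_le _)
  obtain ⟨hX, -, hr, hs⟩ := H₁ k (hd.trans_le (min_le_left _ _)) (hVk.trans_le (min_le_left _ _))
  have hdir := hT.direction k 0 (Nat.zero_le _)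
  have hregk := hreg k 0 (Nat.zero_le _)
  rw [op, hH, hr] at hdir
  rw [hr] at hregk
  have hobj := hT.objective_le hp hcl (k + 1)
  rw [hX] at hobj ⊢
  exact ⟨hs, H₂ _ (hT.mem_stiefel hp.retr k) (hd.trans_le (min_le_right _ _)) _ (hT.s_pos k).le
    hregk _ (hVk.trans_le (min_le_right _ _)) hdir hobj⟩

theorem mem_stiefel_of_mapClusterPt (hT : T.IsGenerated P f h R Lh M₂) (hR : IsRetraction R)
    {Xs : Mat n r} (hcl : MapClusterPt Xs atTop T.X) : Xs ∈ Stiefel n r :=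
  isClosed_stiefel.mem_of_mapClusterPt hcl (Eventually.of_forall (hT.mem_stiefel hR))

/-- With `ε = L_h M₂` the error contracts near `Xs`, so one sufficiently late iterate in the ball
keeps all later ones inside. -/
theorem tendsto_point (hT : T.IsGenerated P f h R Lh M₂) (hp : IsProblem f h R L Lh M₂)
    (hH : ∀ k, T.H k = rHess f (T.X k)) (hV : ∀ k, ∀ j ≤ T.J k, T.V k j ≠ 0)
    {Xs : Mat n r} (hcl : MapClusterPt Xs atTop T.X) {δ : ℝ}
    (hδ : 5 * (Lh : ℝ) * M₂ < δ) (hHess : δ ≤ lambdaMin (pullbackHess f R Xs)) :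
    Tendsto T.X atTop (𝓝 Xs) := by
  have hXs := hT.mem_stiefel_of_mapClusterPt hp.retr hcl
  have hLM := hp.mul_pos
  obtain ⟨S, hS, hreg⟩ := hT.exists_reg_le hp hH hV
  obtain ⟨τ, hτ, hev⟩ := hT.exists_error_le hp hH hV hXs hcl hδ hHess hLM
  obtain ⟨K, hK⟩ := eventually_atTop.1 hev
  obtain ⟨m, hm, hKm⟩ := ((hcl.frequently (Metric.ball_mem_nhds Xs hτ)).and_eventually
    (eventually_ge_atTop K)).exists
  have hsS : ∀ k, T.s k ≤ S := fun k => by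
    refine le_trans ?_ (hreg k 0 (Nat.zero_le _))
    rw [reg]
    exact le_mul_of_one_le_left (hT.s_pos k).le (one_le_pow₀ P.γ₂_gt.le)
  -- The contraction factor `(s + L_h M₂) / (s + 3 L_h M₂)` increases with `s`, so its value at `S`
  -- bounds all of them.
  set q := (S + Lh * M₂) / (S + 3 * (Lh * M₂)) with hq
  have hden : 0 < S + 3 * (Lh * M₂) := by positivity
  have hq0 : 0 ≤ q := by positivity
  have hq1 : q < 1 := by rw [hq, div_lt_one hden]; linarith
  have hstep : ∀ k ≥ K, ‖T.X k - Xs‖ < τ →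
      ‖T.X (k + 1) - Xs‖ ^ 2 ≤ q * ‖T.X k - Xs‖ ^ 2 := by
    intro k hk hd
    have h1 := (hK k hk hd).2
    have hs0 := hT.s_pos k
    have h2 : T.s k + Lh * M₂ ≤ q * (3 * Lh * M₂ + T.s k) := by
      rw [hq, div_mul_eq_mul_div, le_div_iff₀ hden]
      nlinarith [mul_le_mul_of_nonneg_left (hsS k) hLM.le]
    have h3 := mul_le_mul_of_nonneg_right h2 (sq_nonneg ‖T.X k - Xs‖)
    have h4 : 0 < 3 * Lh * M₂ + T.s k := by linarith
    refine le_of_mul_le_mul_left (h1.trans (h3.trans (le_of_eq ?_))) h4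
    ring
  have hgeo : ∀ i, ‖T.X (m + i) - Xs‖ < τ ∧
      ‖T.X (m + i) - Xs‖ ^ 2 ≤ q ^ i * ‖T.X m - Xs‖ ^ 2 := by
    intro i
    induction i with
    | zero => exact ⟨by simpa [dist_eq_norm] using hm, by simp⟩
    | succ i ih =>
      have h1 := hstep (m + i) (hKm.trans (Nat.le_add_right _ _)) ih.1
      refine ⟨?_, ?_⟩
      · refine lt_of_le_of_lt ((pow_le_pow_iff_left₀ (norm_nonneg _) (norm_nonneg _)
          two_ne_zero).1 ?_) ih.1
        exact h1.trans (mul_le_of_le_one_left (sq_nonneg _) hq1.le)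
      · rw [pow_succ' q, mul_assoc]
        exact h1.trans (mul_le_mul_of_nonneg_left ih.2 hq0)
  have hsq : Tendsto (fun i => ‖T.X (m + i) - Xs‖ ^ 2) atTop (𝓝 0) := by
    have h1 := (tendsto_pow_atTop_nhds_zero_of_lt_one hq0 hq1).mul_const (‖T.X m - Xs‖ ^ 2)
    rw [zero_mul] at h1
    exact squeeze_zero (fun i => sq_nonneg _) (fun i => (hgeo i).2) h1
  have h2 := hsq.sqrt
  simp only [Real.sqrt_sq (norm_nonneg _), Real.sqrt_zero] at h2
  rw [← tendsto_add_atTop_iff_nat m, tendsto_iff_norm_sub_tendsto_zero]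
  simpa only [add_comm m] using h2

end Run.IsGenerated

end ARPN

/-! ### The superlinear rate. -/

theorem mainTheorem5 {n r : ℕ}
    -- the objective `F = f + h`
    (f h : ARPN.Mat n r → ℝ) (L Lh : ℝ≥0)
    (hf : ContDiff ℝ 2 f) (hfL : LipschitzWith L (gradient f))
    (hh : ConvexOn ℝ Set.univ h) (hhL : LipschitzWith Lh h) (hLh : 0 < Lh)
    -- the retraction
    (R : ARPN.Mat n r → ARPN.Mat n r → ARPN.Mat n r) (M₂ : ℝ) (hM₂ : 0 < M₂)
    (hR : ARPN.IsRetraction R) (hR₂ : ARPN.IsSecondOrder R)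
    (hRL : ARPN.HasLipschitzDifferential R M₂)
    -- the run of the algorithm with exact Hessians and nonzero search directions
    (P : ARPN.Params) (T : ARPN.Run n r) (hT : T.IsGenerated P f h R Lh M₂)
    (hH : ∀ k, T.H k = ARPN.rHess f (T.X k))
    (hV : ∀ k, ∀ j ≤ T.J k, T.V k j ≠ 0)
    -- the accumulation point
    (Xs : ARPN.Mat n r) (hXs : MapClusterPt Xs atTop T.X)
    (δ : ℝ) (hδ : 5 * (Lh : ℝ) * M₂ < δ)
    (hHess : δ ≤ ARPN.lambdaMin (ARPN.pullbackHess f R Xs)) :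
    ARPN.ConvergesQSuperlinearly T.X Xs := by
  have hp : ARPN.IsProblem f h R L Lh M₂ :=
    ⟨hf, hfL, hh, hhL, NNReal.coe_pos.2 hLh, hR, hR₂, hM₂, hRL⟩
  have hmem := hT.mem_stiefel_of_mapClusterPt hR hXs
  have hLM := hp.mul_pos
  have hlim := hT.tendsto_point hp hH hV hXs hδ hHess
  have hnear : ∀ τ > 0, ∀ᶠ k in atTop, ‖T.X k - Xs‖ < τ := fun τ hτ => by
    simpa [dist_eq_norm] using Metric.tendsto_nhds.1 hlim τ hτ
  -- Every late iteration is very successful, so the parameter is eventually a geometric sequence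
  -- with factor `γ₁`.
  have hs0 : Tendsto T.s atTop (𝓝 0) := by
    obtain ⟨τ, hτ, hev⟩ := hT.exists_error_le hp hH hV hmem hXs hδ hHess hLM
    obtain ⟨K, hK⟩ := eventually_atTop.1 (hev.and (hnear τ hτ))
    have hgeo : ∀ i, T.s (i + K) = P.γ₁ ^ i * T.s K := by
      intro i
      induction i with
      | zero => simp
      | succ i ih =>
        obtain ⟨h1, h2⟩ := hK (i + K) (Nat.le_add_left _ _)
        rw [add_right_comm, (h1 h2).1, ih, pow_succ']
        ring
    rw [← tendsto_add_atTop_iff_nat K]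
    simp only [hgeo]
    simpa using (tendsto_pow_atTop_nhds_zero_of_lt_one P.γ₁_pos.le P.γ₁_lt).mul_const (T.s K)
  refine ⟨hlim, Asymptotics.isLittleO_iff.2 fun c hc => ?_⟩
  -- With `ε` and eventually `σ_k` bounded by `L_h M₂ c²`, the squared error is multiplied by at
  -- most `2c²/3 ≤ c²`.
  obtain ⟨τ, hτ, hev⟩ := hT.exists_error_le hp hH hV hmem hXs hδ hHess
    (ε := Lh * M₂ * c ^ 2) (by positivity)
  filter_upwards [hev, hnear τ hτ, hs0.eventually_lt_const (by positivity : 0 < Lh * M₂ * c ^ 2)]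
    with k hk hd hs
  have h1 := (hk hd).2
  have hsk := hT.s_pos k
  have h2 : (3 * (Lh * M₂)) * ‖T.X (k + 1) - Xs‖ ^ 2 ≤
      (3 * (Lh * M₂)) * (c * ‖T.X k - Xs‖) ^ 2 := by
    have a1 := mul_le_mul_of_nonneg_right hs.le (sq_nonneg ‖T.X k - Xs‖)
    have a2 : 0 ≤ T.s k * ‖T.X (k + 1) - Xs‖ ^ 2 := by positivity
    have a3 : 0 ≤ Lh * M₂ * c ^ 2 * ‖T.X k - Xs‖ ^ 2 := by positivity
    linarith
  exact (pow_le_pow_iff_left₀ (norm_nonneg _) (by positivity) two_ne_zero).1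
    (le_of_mul_le_mul_left h2 (by positivity))
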